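/- Let $X$ be a connected Stein manifold of dimension $n$ and let $f\colon X\to\mathbb{C}$ be a nonconstant holomorphic function with smooth reduced zero fiber, i.e. $d_xf\neq 0$ for every $x\in X$ with $f(x)=0$. Let $$\overline{X}=\{(u,v,x)\in\mathbb{C}^2\times X : uv-f(x)=0\}$$ be the suspension of $X$ along $f$, a closed complex submanifold of $\mathbb{C}^2\times X$ of dimension $n+1$. A holomorphic vector field on $X$ is called complete if through every point of $X$ it has an integral curve defined for all complex times. (1) Suppose that $X$ is holomorphically flexible, i.e. that for every $x\in X$ the values at $x$ of the complete holomorphic vector fields on $X$ span $T_xX$. Then the group $\operatorname{Aut}(\overline{X})$ of holomorphic automorphisms of $\overline{X}$ acts transitively on $\overline{X}$. (2) Let $\omega$ be a holomorphic volume form on $X$ (a nowhere vanishing holomorphic $n$-form), and let $\overline{\omega}$ be the canonical volume form on $\overline{X}$ determined by $d(uv-f)\wedge\overline{\omega}=(du\wedge dv\wedge\omega)|_{\overline{X}}$. Suppose that $X$ is holomorphically volume flexible at some point $x\in X$, i.e. that the values at $x$ of the complete holomorphic vector fields $\Theta$ on $X$ with $\mathcal{L}_\Theta\omega=0$ span $T_xX$,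 and that the group $\operatorname{Aut}_\omega(X)$ of holomorphic automorphisms of $X$ preserving $\omega$ acts transitively on $X$. Then the group $\operatorname{Aut}_{\overline{\omega}}(\overline{X})$ of holomorphic automorphisms of $\overline{X}$ preserving $\overline{\omega}$ acts transitively on $\overline{X}$. -/

import Mathlib

open scoped Manifold ContDiff

noncomputable section

namespace Suspension

section Manifold

variable {E : Type*} [NormedAddCommGroup E] [NormedSpace ℂ E]
  {X : Type*} [TopologicalSpace X] [ChartedSpace E X] [IsManifold 𝓘(ℂ, E) ω X]

variable (E) in
/-- A holomorphic function on the complex manifold `X` modelled on `E`. -/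
def IsHolFun (g : X → ℂ) : Prop := ContMDiff 𝓘(ℂ, E) 𝓘(ℂ, ℂ) ω g

variable (E) in
/-- The hull of `K` with respect to all holomorphic functions on `X`. -/
def holHull (K : Set X) : Set X :=
  {x | ∀ g : X → ℂ, IsHolFun E g → ∀ c : ℝ, (∀ y ∈ K, ‖g y‖ ≤ c) → ‖g x‖ ≤ c}

variable (E X) in
/-- The (Hausdorff, second countable, finite-dimensional) complex manifold `X` is Stein: it is
holomorphically convex and its global holomorphic functions separate points. -/
structure IsStein : Prop where
  holConvex : ∀ K : Set X, IsCompact K → IsCompact (holHull E K)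
  separates : ∀ x y : X, x ≠ y → ∃ g : X → ℂ, IsHolFun E g ∧ g x ≠ g y

variable (E X) in
/-- Sections of the tangent bundle (no regularity). -/
abbrev VField : Type _ := ∀ x : X, TangentSpace 𝓘(ℂ, E) x

/-- Holomorphic vector fields. -/
def IsHolField (Θ : VField E X) : Prop :=
  ContMDiff 𝓘(ℂ, E) 𝓘(ℂ, E).tangent ω (fun x => (⟨x, Θ x⟩ : TangentBundle 𝓘(ℂ, E) X))

/-- Complete holomorphic vector fields: through every point there is an integral curve which is
defined for all complex times. -/
def IsCompleteField (Θ : VField E X) : Prop :=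
  IsHolField Θ ∧ ∀ x : X, ∃ γ : ℂ → X, γ 0 = x ∧
    ∀ t : ℂ, HasMFDerivAt 𝓘(ℂ, ℂ) 𝓘(ℂ, E) γ t ((1 : ℂ →L[ℂ] ℂ).smulRight (Θ (γ t)))

variable (E X) in
/-- Sections of the canonical bundle, i.e. differential forms of top degree (no regularity). -/
abbrev TopForm : Type _ :=
  ∀ x : X, TangentSpace 𝓘(ℂ, E) x [⋀^Fin (Module.finrank ℂ E)]→L[ℂ] ℂ

/-- The expression of a form of top degree in the preferred chart at `x₀`: its pullback under the
inverse of the chart. -/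
def TopForm.inChart (η : TopForm E X) (x₀ : X) (y : E) :
    E [⋀^Fin (Module.finrank ℂ E)]→L[ℂ] ℂ :=
  (η ((extChartAt 𝓘(ℂ, E) x₀).symm y)).compContinuousLinearMap
    (mfderiv 𝓘(ℂ, E) 𝓘(ℂ, E) (extChartAt 𝓘(ℂ, E) x₀).symm y)

/-- The expression of a vector field in the preferred chart at `x₀`. -/
def VField.inChart (Θ : VField E X) (x₀ : X) (y : E) : E :=
  VectorField.mpullback 𝓘(ℂ, E) 𝓘(ℂ, E) (extChartAt 𝓘(ℂ, E) x₀).symm Θ y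

/-- A holomorphic volume form: a holomorphic form of top degree without zeros. -/
def IsVolumeForm (η : TopForm E X) : Prop :=
  (∀ x₀ : X, ContDiffOn ℂ ω (η.inChart x₀) (extChartAt 𝓘(ℂ, E) x₀).target) ∧ ∀ x : X, η x ≠ 0

/-- The Lie derivative `(L_V β)_y (w₁, …, w_k)` of a differential form `β` along a vector field `V`
on (an open subset of) the vector space `E`. -/
def lieDeriv {k : ℕ} (V : E → E) (β : E → E [⋀^Fin k]→L[ℂ] ℂ) (y : E) (w : Fin k → E) : ℂ :=
  (fderiv ℂ β y (V y)) w + ∑ i, β y (Function.update w i (fderiv ℂ V y (w i)))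

/-- `L_Θ η = 0`, i.e. `Θ` has divergence zero with respect to the volume form `η`. -/
def IsDivFree (η : TopForm E X) (Θ : VField E X) : Prop :=
  ∀ x₀ : X, ∀ y ∈ (extChartAt 𝓘(ℂ, E) x₀).target, ∀ w : Fin (Module.finrank ℂ E) → E,
    lieDeriv (Θ.inChart x₀) (η.inChart x₀) y w = 0

variable (E X) in
/-- Holomorphic flexibility: the complete fields span every tangent space. -/
def IsFlexible : Prop :=
  ∀ x : X, Submodule.span ℂ {ξ : TangentSpace 𝓘(ℂ, E) x |
    ∃ Θ : VField E X, IsCompleteField Θ ∧ Θ x = ξ} = ⊤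

/-- Holomorphic volume flexibility at the point `x`. -/
def IsVolumeFlexibleAt (η : TopForm E X) (x : X) : Prop :=
  Submodule.span ℂ {ξ : TangentSpace 𝓘(ℂ, E) x |
    ∃ Θ : VField E X, IsCompleteField Θ ∧ IsDivFree η Θ ∧ Θ x = ξ} = ⊤

/-- `Aut_η(X)`: the holomorphic automorphisms of `X` that preserve `η`. -/
def volumeAut (η : TopForm E X) : Set (Diffeomorph 𝓘(ℂ, E) 𝓘(ℂ, E) X X ω) :=
  {Φ | ∀ x : X, (η (Φ x)).compContinuousLinearMap (mfderiv 𝓘(ℂ, E) 𝓘(ℂ, E) Φ x) = η x}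

end Manifold

section Suspension

variable {E : Type*} [NormedAddCommGroup E] [NormedSpace ℂ E]
  {X : Type*} [TopologicalSpace X] [ChartedSpace E X]

variable (E) in
/-- The model of the manifold `ℂ × ℂ × X`. -/
abbrev ambI : ModelWithCorners ℂ (ℂ × ℂ × E) (ModelProd ℂ (ModelProd ℂ E)) :=
  𝓘(ℂ, ℂ).prod (𝓘(ℂ, ℂ).prod 𝓘(ℂ, E))

/-- The defining function `uv - f(x)` on `ℂ × ℂ × X`. -/
def defFun (f : X → ℂ) (q : ℂ × ℂ × X) : ℂ := q.1 * q.2.1 - f q.2.2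

/-- The suspension `{(u, v, x) : uv - f(x) = 0}` of `X` along `f`. -/
def Susp (f : X → ℂ) : Type _ := {q : ℂ × ℂ × X // defFun f q = 0}

variable (E) in
/-- The differential of `uv - f(x)` at `q`. -/
def dDef (f : X → ℂ) (q : ℂ × ℂ × X) : TangentSpace (ambI E) q →ₗ[ℂ] ℂ :=
  (mfderiv (ambI E) 𝓘(ℂ, ℂ) (defFun f) q).toLinearMap

variable (E) in
/-- The tangent space of the suspension at `p`, as a subspace of the ambient tangent space. -/
def tangent (f : X → ℂ) (p : Susp f) : Submodule ℂ (TangentSpace (ambI E) p.1) :=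
  LinearMap.ker (dDef E f p.1)

variable (E) in
/-- `Φ : X̄ → X̄` is holomorphic at `p` with differential `L : T_p X̄ → T_{Φ(p)} X̄`: near `p`, it is
the restriction to the submanifold `X̄` of a holomorphic map `F` of `ℂ × ℂ × X`, whose differential
restricts to `L`. -/
def HasHolDerivAt (f : X → ℂ) (Φ : Susp f → Susp f) (p : Susp f)
    (L : tangent E f p →ₗ[ℂ] tangent E f (Φ p)) : Prop :=
  ∃ (U : Set (ℂ × ℂ × X)) (F : ℂ × ℂ × X → ℂ × ℂ × X), IsOpen U ∧ p.1 ∈ U ∧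
    ContMDiffOn (ambI E) (ambI E) ω F U ∧ (∀ q : Susp f, q.1 ∈ U → F q.1 = (Φ q).1) ∧
    ∀ w : tangent E f p,
      mfderiv (ambI E) (ambI E) F p.1 (w : TangentSpace (ambI E) p.1) =
        (L w : TangentSpace (ambI E) (Φ p).1)

variable (E) in
/-- Holomorphic self-maps of the suspension. -/
def IsHolMap (f : X → ℂ) (Φ : Susp f → Susp f) : Prop :=
  ∀ p : Susp f, ∃ L : tangent E f p →ₗ[ℂ] tangent E f (Φ p), HasHolDerivAt E f Φ p L

variable (E) in
/-- `Aut(X̄)`, the holomorphic automorphisms of the suspension. -/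
def aut (f : X → ℂ) : Set (Susp f ≃ Susp f) :=
  {Φ | IsHolMap E f Φ ∧ IsHolMap E f Φ.symm}

/-- The wedge product `α ∧ β` of a linear form `α` with an alternating `k`-form `β`:
`(α ∧ β)(w₀, …, w_k) = ∑ i, (-1)^i α(w_i) β(w₀, …, ŵ_i, …, w_k)`. -/
def wedge {M : Type*} [AddCommGroup M] [Module ℂ M] {k : ℕ}
    (α : M →ₗ[ℂ] ℂ) (β : M [⋀^Fin k]→ₗ[ℂ] ℂ) : M [⋀^Fin (k + 1)]→ₗ[ℂ] ℂ :=
  AlternatingMap.alternatizeUncurryFin (α.smulRight β)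

/-- The form `Ω = du ∧ dv ∧ η` on `ℂ × ℂ × X`. -/
def ambForm (η : TopForm E X) (q : ℂ × ℂ × X) :
    TangentSpace (ambI E) q [⋀^Fin (Module.finrank ℂ E + 2)]→ₗ[ℂ] ℂ :=
  wedge (mfderiv (ambI E) 𝓘(ℂ, ℂ) (fun r : ℂ × ℂ × X => r.1) q).toLinearMap
    (wedge (mfderiv (ambI E) 𝓘(ℂ, ℂ) (fun r : ℂ × ℂ × X => r.2.1) q).toLinearMap
      ((η q.2.2).toAlternatingMap.compLinearMap
        (mfderiv (ambI E) 𝓘(ℂ, E) (fun r : ℂ × ℂ × X => r.2.2) q).toLinearMap))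

/-- The canonical form `η̄` on the suspension, characterized by `d(uv - f) ∧ η̄ = Ω` along `X̄`:
it is the restriction to `X̄` of `ι_ν Ω`, where `ν` is any vector with `d(uv - f)(ν) = 1`. -/
def suspForm (f : X → ℂ) (η : TopForm E X) (p : Susp f) :
    tangent E f p [⋀^Fin (Module.finrank ℂ E + 1)]→ₗ[ℂ] ℂ :=
  ((ambForm η p.1).curryLeft (Classical.epsilon fun ν => dDef E f p.1 ν = 1)).compLinearMap
    (tangent E f p).subtype

/-- The coordinate expression of `d(uv - f)`. -/
theorem dDef_apply (f : X → ℂ) (q : ℂ × ℂ × X) (D : E →L[ℂ] ℂ)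
    (hD : HasMFDerivAt 𝓘(ℂ, E) 𝓘(ℂ, ℂ) f q.2.2 D) (a b : ℂ) (ξ : E) :
    dDef E f q ((a, b, ξ) : ℂ × ℂ × E) = q.2.1 * a + q.1 * b - D ξ := by
  have h1 : HasMFDerivAt (ambI E) 𝓘(ℂ, ℂ) (fun r : ℂ × ℂ × X => r.1) q
      (ContinuousLinearMap.fst ℂ ℂ (ℂ × E)) := hasMFDerivAt_fst q
  have h2 : HasMFDerivAt (ambI E) (𝓘(ℂ, ℂ).prod 𝓘(ℂ, E)) (fun r : ℂ × ℂ × X => r.2) q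
      (ContinuousLinearMap.snd ℂ ℂ (ℂ × E)) := hasMFDerivAt_snd q
  have h3 : HasMFDerivAt (𝓘(ℂ, ℂ).prod 𝓘(ℂ, E)) 𝓘(ℂ, ℂ) (fun r : ℂ × X => r.1) q.2
      (ContinuousLinearMap.fst ℂ ℂ E) := hasMFDerivAt_fst q.2
  have h4 : HasMFDerivAt (𝓘(ℂ, ℂ).prod 𝓘(ℂ, E)) 𝓘(ℂ, E) (fun r : ℂ × X => r.2) q.2
      (ContinuousLinearMap.snd ℂ ℂ E) := hasMFDerivAt_snd q.2
  have h6 := (h1.mul (h3.comp q h2)).sub ((hD.comp q.2 h4).comp q h2)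
  have h7 : mfderiv (ambI E) 𝓘(ℂ, ℂ) (defFun f) q = _ := h6.mfderiv
  unfold dDef
  rw [h7]
  change q.1 * b + q.2.1 * a - _ = _
  rw [add_comm]
  rfl

theorem dDef_surj (f : X → ℂ) (hf : ContMDiff 𝓘(ℂ, E) 𝓘(ℂ, ℂ) ω f)
    (hred : ∀ x : X, f x = 0 → mfderiv 𝓘(ℂ, E) 𝓘(ℂ, ℂ) f x ≠ 0) (p : Susp f) :
    ∃ ν, dDef E f p.1 ν = 1 := by
  suffices h : dDef E f p.1 ≠ 0 from LinearMap.surjective h 1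
  intro h0
  have hD := (hf.mdifferentiable (by simp) p.1.2.2).hasMFDerivAt
  set D : E →L[ℂ] ℂ := mfderiv 𝓘(ℂ, E) 𝓘(ℂ, ℂ) f p.1.2.2 with hDdef
  have h : ∀ (a b : ℂ) (ξ : E), p.1.2.1 * a + p.1.1 * b - D ξ = 0 := fun a b ξ => by
    rw [← dDef_apply f p.1 D hD, h0]; rfl
  have hu : p.1.1 = 0 := by simpa using h 0 1 0
  have hp : p.1.1 * p.1.2.1 - f p.1.2.2 = 0 := p.2
  refine hred p.1.2.2 (by simpa [hu] using hp) ?_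
  have hD0 : D = 0 := ContinuousLinearMap.ext fun ξ => by simpa using h 0 0 ξ
  exact hD0

/-- The evaluation of the identity `d(uv - f) ∧ η̄ = Ω` on a vector `ν` of the ambient tangent space
and on vectors `w` tangent to the suspension. -/
theorem dDef_mul_suspForm [FiniteDimensional ℂ E] (f : X → ℂ)
    (hf : ContMDiff 𝓘(ℂ, E) 𝓘(ℂ, ℂ) ω f)
    (hred : ∀ x : X, f x = 0 → mfderiv 𝓘(ℂ, E) 𝓘(ℂ, ℂ) f x ≠ 0)
    (η : TopForm E X) (p : Susp f) (ν : TangentSpace (ambI E) p.1)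
    (w : Fin (Module.finrank ℂ E + 1) → tangent E f p) :
    dDef E f p.1 ν * suspForm f η p w =
      ambForm η p.1 (Matrix.vecCons ν fun i => (w i : TangentSpace (ambI E) p.1)) := by
  set ν₀ : TangentSpace (ambI E) p.1 := Classical.epsilon fun ν => dDef E f p.1 ν = 1 with hν₀
  have h1 : dDef E f p.1 ν₀ = 1 := Classical.epsilon_spec (dDef_surj f hf hred p)
  have hker : ν - dDef E f p.1 ν • ν₀ ∈ tangent E f p := by
    simp [tangent, h1]
  have hdep : ¬ LinearIndependent ℂ (Matrix.vecCons (ν - dDef E f p.1 ν • ν₀)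
      fun i => (w i : TangentSpace (ambI E) p.1)) := by
    intro hli
    have : FiniteDimensional ℂ (TangentSpace (ambI E) p.1) :=
      inferInstanceAs (FiniteDimensional ℂ (ℂ × ℂ × E))
    have hdim : Module.finrank ℂ (TangentSpace (ambI E) p.1) = Module.finrank ℂ E + 2 := by
      change Module.finrank ℂ (ℂ × ℂ × E) = _
      simp only [Module.finrank_prod, Module.finrank_self]
      omega
    have htop := hli.span_eq_top_of_card_eq_finrank' (by rw [hdim]; simp)
    have hle : (⊤ : Submodule ℂ (TangentSpace (ambI E) p.1)) ≤ tangent E f p := by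
      rw [← htop, Submodule.span_le]
      rintro _ ⟨i, rfl⟩
      refine Fin.cases ?_ (fun j => ?_) i
      · exact hker
      · exact (w j).2
    have : dDef E f p.1 ν₀ = 0 := hle (Submodule.mem_top (x := ν₀))
    exact one_ne_zero (h1.symm.trans this)
  have hz := (ambForm η p.1).map_linearDependent _ hdep
  have hsplit : ν = (ν - dDef E f p.1 ν • ν₀) + dDef E f p.1 ν • ν₀ := by abel
  conv_rhs => rw [hsplit]
  rw [AlternatingMap.map_vecCons_add, hz, zero_add, AlternatingMap.map_vecCons_smul]
  rfl

/-- `Aut_η̄(X̄)`, the holomorphic automorphisms of the suspension that preserve `η̄`. -/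
def suspVolumeAut (f : X → ℂ) (η : TopForm E X) : Set (Susp f ≃ Susp f) :=
  {Φ | Φ ∈ aut E f ∧ ∀ p : Susp f, ∃ L : tangent E f p →ₗ[ℂ] tangent E f (Φ p),
    HasHolDerivAt E f Φ p L ∧ (suspForm f η (Φ p)).compLinearMap L = suspForm f η p}

end Suspension

end Suspension

end

/-! A complete field Θ on X with flow φ lifts to the field uΘ + Θ(f)∂_v on ℂ² × X. The lift
annihilates uv - f and is complete: its time-t map sends (u, v, x) to (u, v + (f(φ_{tu}(x)) -
f(x))/u, φ_{tu}(x)), where the quotient extends holomorphically to u = 0 with value tΘ(f)(x). These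
maps are the shears. Together with (u, v, x) ↦ (lu, l⁻¹v, x) and the exchange of u and v they are
automorphisms of the ambient space that preserve uv - f, so they restrict to the suspension.

Transitivity is an orbit count (`exists_mem_map_eq`). A slice of the suspension at fixed u ≠ 0 is a
graph over X, on which the shears move x along the given flows. Spanning velocities and
connectedness put the slice in one orbit (`mem_nhds_of_span_flowVelocity`,
`rel_of_span_flowVelocity`), and the hyperbolic maps join the slices. By symmetry the points with v
≠ 0 also form part of one orbit, and the two sets meet where f ≠ 0. If u = v = 0, then f(x) = 0, so
df ≠ 0 at x and some shear makes v nonzero.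

For the volume statement, the differential of a shear is triangular with diagonal blocks 1, 1, dφ,
so a shear along a volume preserving flow preserves du ∧ dv ∧ ω (`scalesForm_shear`). As it also
preserves uv - f, it preserves the quotient form on the suspension. The exchange reverses the sign
of du ∧ dv ∧ ω, so only conjugation by it is used. Volume flexibility at one point spreads to all
points by conjugating flows with volume preserving automorphisms.

The analytic foundation is that a complete field has a jointly holomorphic flow
(`IsCompleteField.exists_flow`), which preserves ω if the field is divergence free
(`preservesForm_flow`). Local analytic dependence on time and initial value comes from the implicit
function theorem on a Banach space of curves (`exists_contDiffAt_solution`). -/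

namespace Suspension

open Set Filter Topology

/-! ### Analytic maps acting on continuous curves. -/

section Curves

variable {E F : Type*} [NormedAddCommGroup E] [NormedSpace ℂ E]
  [NormedAddCommGroup F] [NormedSpace ℂ F]

/-- The pointwise action of a continuous multilinear map on continuous functions. -/
noncomputable def pointwiseMultilinear (K : Type*) [TopologicalSpace K] [CompactSpace K] {n : ℕ}
    (p : E [×n]→L[ℂ] F) : C(K, E) [×n]→L[ℂ] C(K, F) :=
  MultilinearMap.mkContinuous
    { toFun := fun m => ⟨fun k => p fun i => m i k, by fun_prop⟩
      map_update_add' := by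
        intro _ m i x y
        ext k
        have h (z : C(K, E)) : (fun j => (Function.update m i z) j k)
            = Function.update (fun j => m j k) i (z k) := by
          ext j
          rcases eq_or_ne j i with rfl | hj <;> simp [*]
        simp [h]
      map_update_smul' := by
        intro _ m i c x
        ext k
        have h (z : C(K, E)) : (fun j => (Function.update m i z) j k)
            = Function.update (fun j => m j k) i (z k) := by
          ext j
          rcases eq_or_ne j i with rfl | hj <;> simp [*]
        simp [h] }
    ‖p‖ (by
      intro m
      refine (ContinuousMap.norm_le _ (by positivity)).2 fun k => ?_
      refine (p.le_opNorm _).trans ?_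
      gcongr
      exact (m _).norm_coe_le_norm k)

theorem norm_pointwiseMultilinear_le (K : Type*) [TopologicalSpace K] [CompactSpace K] {n : ℕ}
    (p : E [×n]→L[ℂ] F) : ‖pointwiseMultilinear K p‖ ≤ ‖p‖ :=
  MultilinearMap.mkContinuous_norm_le _ (norm_nonneg _) _

/-- Composition with an analytic map is analytic on the space of continuous functions, near a
constant function. -/
theorem exists_contDiffAt_comp (K : Type*) [TopologicalSpace K] [CompactSpace K] [CompleteSpace F]
    {V : E → F} {y₀ : E} (hV : ContDiffAt ℂ ω V y₀) :
    ∃ N : C(K, E) → C(K, F), ContDiffAt ℂ ω N (ContinuousMap.const K y₀) ∧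
      ∀ᶠ γ in 𝓝 (ContinuousMap.const K y₀), ∀ k, N γ k = V (γ k) := by
  obtain ⟨p, r, hp⟩ := hV.analyticAt
  -- Pointwise application does not increase the norms of the Taylor coefficients, so the series on
  -- curves converges at least where that of `V` does.
  let q : FormalMultilinearSeries ℂ C(K, E) C(K, F) := fun n => pointwiseMultilinear K (p n)
  have hqr : p.radius ≤ q.radius :=
    FormalMultilinearSeries.radius_le_of_le fun n => norm_pointwiseMultilinear_le K (p n)
  have hq0 : 0 < q.radius := (hp.r_pos.trans_le hp.r_le).trans_le hqr
  have hq := q.hasFPowerSeriesOnBall hq0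
  -- `V ∘ γ` need not be continuous for curves far from the constant one, so `N` is defined by the
  -- series; its values outside the ball of convergence are irrelevant.
  refine ⟨fun γ => q.sum (γ - ContinuousMap.const K y₀), ?_, ?_⟩
  · have h1 := (hq.comp_sub (ContinuousMap.const K y₀)).analyticAt
    rw [zero_add] at h1
    exact h1.contDiffAt
  · filter_upwards [Metric.eball_mem_nhds _ hp.r_pos] with γ hγ k
    have hγ' : γ - ContinuousMap.const K y₀ ∈ Metric.eball (0 : C(K, E)) q.radius := by
      rw [Metric.mem_eball, edist_zero_right]
      rw [Metric.mem_eball, edist_eq_enorm_sub] at hγ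
      exact hγ.trans_le (hp.r_le.trans hqr)
    -- Evaluation at `k` is continuous and linear, so it turns the series of `N` at `γ` into the
    -- Taylor series of `V` at `γ k`.
    have h1 := (ContinuousMap.evalCLM ℂ k).hasSum (q.hasSum hγ')
    have h2 : γ k - y₀ ∈ Metric.eball (0 : E) r := by
      rw [Metric.mem_eball, edist_zero_right]
      rw [Metric.mem_eball, edist_eq_enorm_sub] at hγ
      refine lt_of_le_of_lt ?_ hγ
      exact enorm_le_iff_norm_le.2 ((γ - ContinuousMap.const K y₀).norm_coe_le_norm k)
    have h3 := hp.hasSum h2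
    rw [add_sub_cancel] at h3
    exact h1.unique h3

end Curves

/-! ### Local analytic solutions of differential equations, and divided differences. -/

section LocalFlow

variable {E F : Type*} [NormedAddCommGroup E] [NormedSpace ℂ E]
  [NormedAddCommGroup F] [NormedSpace ℂ F]

/-- The compact interval of times on which local solutions are constructed. -/
abbrev TimeInterval : Type := Icc (-2 : ℝ) 2

/-- The projection of the real line to the interval of times. -/
noncomputable def toTime (r : ℝ) : TimeInterval := projIcc (-2) 2 (by norm_num) r

theorem continuous_toTime : Continuous toTime :=
  continuous_projIcc (h := by norm_num)

theorem coe_toTime {r : ℝ} (hr : r ∈ Icc (-2 : ℝ) 2) : (toTime r : ℝ) = r := by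
  rw [toTime, projIcc_of_mem _ hr]

/-- The primitive vanishing at time zero. -/
noncomputable def primitiveCLM (E : Type*) [NormedAddCommGroup E] [NormedSpace ℂ E] :
    C(TimeInterval, E) →L[ℂ] C(TimeInterval, E) :=
  LinearMap.mkContinuous
    { toFun := fun γ => ⟨fun r => ∫ x in (0 : ℝ)..r, γ (toTime x), by
        have h : Continuous fun b : ℝ => ∫ x in (0 : ℝ)..b, γ (toTime x) :=
          intervalIntegral.continuous_primitive
            (fun a b => (γ.continuous.comp continuous_toTime).intervalIntegrable a b) 0
        exact h.comp continuous_subtype_val⟩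
      map_add' := by
        intro γ δ
        ext r
        exact intervalIntegral.integral_add
          ((γ.continuous.comp continuous_toTime).intervalIntegrable _ _)
          ((δ.continuous.comp continuous_toTime).intervalIntegrable _ _)
      map_smul' := by
        intro c γ
        ext r
        exact intervalIntegral.integral_smul c _ }
    2 (by
      intro γ
      refine (ContinuousMap.norm_le _ (by positivity)).2 fun r => ?_
      have h := intervalIntegral.norm_integral_le_of_norm_le_const
        (f := fun x => γ (toTime x)) (a := 0) (b := r) (C := ‖γ‖)
        fun x _ => γ.norm_coe_le_norm _
      refine h.trans ?_
      rw [mul_comm, sub_zero]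
      gcongr
      exact abs_le.2 r.2)

theorem primitiveCLM_apply (γ : C(TimeInterval, E)) (r : TimeInterval) :
    primitiveCLM E γ r = ∫ x in (0 : ℝ)..r, γ (toTime x) := rfl

/-- Analytic dependence of the solutions of an autonomous analytic differential equation on the
complex time scale and on the initial value. -/
theorem exists_contDiffAt_solution [CompleteSpace E] {V : E → E} {y₀ : E}
    (hV : ContDiffAt ℂ ω V y₀) :
    ∃ c : ℂ × E → E, ContDiffAt ℂ ω c (0, y₀) ∧ ∀ δ > 0, ∀ᶠ p in 𝓝 ((0 : ℂ), y₀),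
      ∃ γ : ℝ → E, γ 0 = p.2 ∧ γ 1 = c p ∧ ∀ r ∈ Ioo (-2 : ℝ) 2,
        γ r ∈ Metric.ball y₀ δ ∧ HasDerivAt γ (p.1 • V (γ r)) r := by
  obtain ⟨N, hN, hNV⟩ := exists_contDiffAt_comp TimeInterval hV
  set k₀ : C(TimeInterval, E) := ContinuousMap.const _ y₀ with hk₀
  let cst : E →L[ℂ] C(TimeInterval, E) :=
    LinearMap.mkContinuous
      { toFun := fun y => ContinuousMap.const _ y
        map_add' := fun _ _ => rfl
        map_smul' := fun _ _ => rfl } 1 (by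
          intro y
          refine (ContinuousMap.norm_le _ (by positivity)).2 fun k => ?_
          rw [one_mul]
          exact le_rfl)
  let u : (ℂ × E) × C(TimeInterval, E) := ((0, y₀), k₀)
  -- A zero of `G` is a curve with γ(r) = y + s∫₀ʳ V(γ), the integral form of γ' = sV(γ). The
  -- parameter `s` carries the complex time, while curves keep a fixed real interval of definition.
  let G : (ℂ × E) × C(TimeInterval, E) → C(TimeInterval, E) :=
    fun q => q.2 - cst q.1.2 - q.1.1 • primitiveCLM E (N q.2)
  have hNu : ContDiffAt ℂ ω (fun q : (ℂ × E) × C(TimeInterval, E) => N q.2) u :=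
    ContDiffAt.comp u (g := N) (f := Prod.snd) hN contDiffAt_snd
  have hGu : ContDiffAt ℂ ω G u := by
    refine (contDiffAt_snd.sub (cst.contDiff.contDiffAt.comp u
      (contDiffAt_snd.comp u contDiffAt_fst))).sub ?_
    exact (contDiffAt_fst.comp u contDiffAt_fst).smul
      ((primitiveCLM E).contDiff.contDiffAt.comp u hNu)
  have hG0 : G u = 0 := by
    simp only [G, u, zero_smul, sub_zero]
    exact sub_self k₀
  -- At s = 0 the integral term disappears, so the partial derivative in the curve is the identity
  -- and the implicit function theorem applies.
  have hinr : fderiv ℂ G u ∘L .inr ℂ (ℂ × E) C(TimeInterval, E)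
      = ContinuousLinearMap.id ℂ C(TimeInterval, E) := by
    have h1 : HasFDerivAt G (fderiv ℂ G u) u :=
      (hGu.differentiableAt (by simp)).hasFDerivAt
    have h2 : HasFDerivAt (fun γ : C(TimeInterval, E) => (((0 : ℂ), y₀), γ))
        (.inr ℂ (ℂ × E) C(TimeInterval, E)) k₀ := hasFDerivAt_prodMk_right _ _
    have h3 := HasFDerivAt.comp k₀ (g := G) h1 h2
    have h4 : (G ∘ fun γ : C(TimeInterval, E) => (((0 : ℂ), y₀), γ)) = fun γ => γ - cst y₀ := by
      ext1 γ
      simp [G]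
    rw [h4] at h3
    exact h3.unique ((hasFDerivAt_id k₀).sub_const _)
  have hinv : (fderiv ℂ G u ∘L .inr ℂ (ℂ × E) C(TimeInterval, E)).IsInvertible := by
    rw [hinr]
    exact ⟨ContinuousLinearEquiv.refl ℂ _, rfl⟩
  set Γ := hGu.implicitFunction (by simp) hinv with hΓ
  have hΓc : ContDiffAt ℂ ω Γ (0, y₀) := hGu.contDiffAt_implicitFunction (by simp) hinv
  have hΓ0 : Γ (0, y₀) = k₀ := hGu.implicitFunction_apply_self (by simp) hinv
  have hΓeq : ∀ᶠ p in 𝓝 ((0 : ℂ), y₀), G (p, Γ p) = G u :=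
    hGu.eventually_apply_implicitFunction (by simp) hinv
  -- The value at 1 of the solution of γ' = sV(γ) is the flow of `V` at time `s`. The times 0 and 1
  -- are interior to [-2, 2].
  refine ⟨fun p => Γ p (toTime 1), ?_, ?_⟩
  · exact ((ContinuousMap.evalCLM ℂ (toTime 1)).contDiff.contDiffAt (n := ω)).comp _ hΓc
  · intro δ hδ
    have hcont : Tendsto Γ (𝓝 (0, y₀)) (𝓝 k₀) := by
      have := hΓc.continuousAt.tendsto
      rwa [hΓ0] at this
    filter_upwards [hΓeq, hcont.eventually hNV, hcont.eventually (Metric.ball_mem_nhds k₀ hδ)]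
      with p h1 h2 h3
    have hfix : ∀ r : TimeInterval,
        Γ p r = p.2 + p.1 • ∫ x in (0 : ℝ)..r, V (Γ p (toTime x)) := by
      intro r
      have h4 := congrArg (fun g : C(TimeInterval, E) => g r) (h1.trans hG0)
      have h5 : Γ p r - p.2 - p.1 • primitiveCLM E (N (Γ p)) r = 0 := h4
      rw [primitiveCLM_apply] at h5
      simp only [h2] at h5
      rw [sub_sub, sub_eq_zero] at h5
      exact h5
    refine ⟨fun r => Γ p (toTime r), ?_, rfl, ?_⟩
    · simp only []
      rw [hfix, coe_toTime (by constructor <;> norm_num)]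
      simp
    · intro r hr
      constructor
      · rw [Metric.mem_ball]
        exact lt_of_le_of_lt (ContinuousMap.dist_apply_le_dist (f := Γ p) (g := k₀) (toTime r)) h3
      · have hVc : Continuous fun x : ℝ => V (Γ p (toTime x)) := by
          have : (fun x : ℝ => V (Γ p (toTime x))) = fun x : ℝ => N (Γ p) (toTime x) := by
            ext x
            rw [h2]
          rw [this]
          exact (N (Γ p)).continuous.comp continuous_toTime
        have h6 : HasDerivAt (fun r : ℝ => p.2 + p.1 • ∫ x in (0 : ℝ)..r, V (Γ p (toTime x)))
            (p.1 • V (Γ p (toTime r))) r :=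
          ((hVc.integral_hasStrictDerivAt 0 r).hasDerivAt.const_smul p.1).const_add p.2
        refine h6.congr_of_eventuallyEq ?_
        filter_upwards [Ioo_mem_nhds hr.1 hr.2] with x hx
        rw [hfix, coe_toTime (Ioo_subset_Icc_self hx)]

/-- The divided difference of an analytic function with respect to its first variable is analytic
in both variables. -/
theorem contDiffAt_dslope [CompleteSpace F] {h : ℂ × E → F} {y₀ : E}
    (hh : ContDiffAt ℂ ω h (0, y₀)) :
    ContDiffAt ℂ ω (fun p : ℂ × E => dslope (fun s => h (s, p.2)) 0 p.1) (0, y₀) := by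
  set D : ℂ × E → F := fun p => fderiv ℂ h p (1, 0) with hD
  have hDc : ContDiffAt ℂ ω D (0, y₀) :=
    (hh.fderiv_right (m := ω) (by simp)).clm_apply contDiffAt_const
  obtain ⟨N, hN, hND⟩ := exists_contDiffAt_comp TimeInterval hDc
  -- Hadamard's formula: the divided difference of `h` at (s, y) is the integral over r in [0, 1] of
  -- ∂₁h(rs, y). The path r ↦ (rs, y) depends linearly on (s, y), so the integral is analytic.
  let T : ℂ × E →L[ℂ] C(TimeInterval, ℂ × E) :=
    LinearMap.mkContinuous
      { toFun := fun p => ⟨fun r => (((r : ℝ) : ℂ) * p.1, p.2), by fun_prop⟩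
        map_add' := by
          intro p q
          ext r <;> simp [mul_add]
        map_smul' := by
          intro a p
          ext r <;> simp [mul_left_comm] } 2 (by
        intro p
        refine (ContinuousMap.norm_le _ (by positivity)).2 fun r => ?_
        have hr : |(r : ℝ)| ≤ 2 := abs_le.2 r.2
        have h1 : ‖p.1‖ ≤ ‖p‖ := norm_fst_le p
        have h2 : ‖p.2‖ ≤ ‖p‖ := norm_snd_le p
        have h3 : 0 ≤ ‖p‖ := norm_nonneg p
        simp only [LinearMap.coe_mk, AddHom.coe_mk, ContinuousMap.coe_mk, Prod.norm_mk, norm_mul,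
          Complex.norm_real, Real.norm_eq_abs]
        refine max_le ?_ (by linarith)
        gcongr)
  have hT0 : T (0, y₀) = ContinuousMap.const _ (0, y₀) := by
    ext r <;> simp [T]
  have hTc : ContDiffAt ℂ ω (fun p => primitiveCLM F (N (T p)) (toTime 1)) (0, y₀) := by
    have h1 : ContDiffAt ℂ ω (fun p => N (T p)) (0, y₀) := by
      refine ContDiffAt.comp (0, y₀) (g := N) (f := T) ?_ T.contDiff.contDiffAt
      rwa [hT0]
    exact ((ContinuousMap.evalCLM ℂ (toTime 1)).contDiff.contDiffAt (n := ω)).comp _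
      (((primitiveCLM F).contDiff.contDiffAt (n := ω)).comp _ h1)
  refine hTc.congr_of_eventuallyEq ?_
  have htend : Tendsto T (𝓝 (0, y₀)) (𝓝 (ContinuousMap.const _ (0, y₀))) := by
    rw [← hT0]
    exact T.continuous.tendsto _
  obtain ⟨ε, hε, hdiff⟩ := Metric.eventually_nhds_iff_ball.1 (hh.eventually (by simp))
  filter_upwards [htend.eventually hND, Metric.ball_mem_nhds _ hε] with p h1 h2
  rw [primitiveCLM_apply, coe_toTime (by constructor <;> norm_num)]
  have hp1 : ∀ x ∈ Icc (0 : ℝ) 1, N (T p) (toTime x) = D ((x : ℂ) * p.1, p.2) := by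
    intro x hx
    rw [h1]
    have : (toTime x : ℝ) = x := coe_toTime ⟨by linarith [hx.1], by linarith [hx.2]⟩
    simp [T, this]
  have hmem : ∀ x ∈ Icc (0 : ℝ) 1, ((x : ℂ) * p.1, p.2) ∈ Metric.ball ((0 : ℂ), y₀) ε := by
    intro x hx
    rw [Metric.mem_ball, Prod.dist_eq, max_lt_iff] at h2 ⊢
    refine ⟨?_, h2.2⟩
    have h3 := h2.1
    simp only [dist_zero_right, norm_mul, Complex.norm_real, Real.norm_eq_abs] at h3 ⊢
    refine lt_of_le_of_lt ?_ h3
    rw [abs_of_nonneg hx.1]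
    exact mul_le_of_le_one_left (norm_nonneg _) hx.2
  have hder : ∀ x ∈ Icc (0 : ℝ) 1,
      HasDerivAt (fun s : ℂ => h (s, p.2)) (D ((x : ℂ) * p.1, p.2)) ((x : ℂ) * p.1) := by
    intro x hx
    have h4 := ((hdiff _ (hmem x hx)).differentiableAt (by simp)).hasFDerivAt
    exact h4.comp_hasDerivAt ((x : ℂ) * p.1)
      ((hasDerivAt_id _).prodMk (hasDerivAt_const _ _))
  rw [intervalIntegral.integral_congr (g := fun x : ℝ => D ((x : ℂ) * p.1, p.2))
    (by intro x hx; rw [uIcc_of_le zero_le_one] at hx; exact hp1 x hx)]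
  rcases eq_or_ne p.1 0 with h0 | h0
  · have h5 := hder 0 ⟨le_rfl, zero_le_one⟩
    simp only [Complex.ofReal_zero, zero_mul] at h5
    simp [h0, h5.deriv]
  · rw [dslope_of_ne _ h0, slope_def_module, sub_zero]
    have hintegral : ∫ x in (0 : ℝ)..1, p.1 • D ((x : ℂ) * p.1, p.2) = h (p.1, p.2) - h (0, p.2) := by
      have hF : ∀ x ∈ uIcc (0 : ℝ) 1, HasDerivAt (fun x : ℝ => h ((x : ℂ) * p.1, p.2))
          (p.1 • D ((x : ℂ) * p.1, p.2)) x := by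
        intro x hx
        rw [uIcc_of_le zero_le_one] at hx
        have h6 : HasDerivAt (fun x : ℝ => (x : ℂ) * p.1) p.1 x := by
          simpa using (Complex.ofRealCLM.hasDerivAt (x := x)).mul_const p.1
        exact (hder x hx).scomp x h6
      have hcont : IntervalIntegrable (fun x : ℝ => p.1 • D ((x : ℂ) * p.1, p.2))
          MeasureTheory.volume 0 1 := by
        refine ContinuousOn.intervalIntegrable ?_
        rw [uIcc_of_le zero_le_one]
        refine ContinuousOn.congr (f := fun x : ℝ => p.1 • N (T p) (toTime x)) ?_ ?_
        · exact (((N (T p)).continuous.comp continuous_toTime).const_smul p.1).continuousOn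
        · intro x hx
          simp only [hp1 x hx]
      have := intervalIntegral.integral_eq_sub_of_hasDerivAt hF hcont
      simpa using this
    rw [intervalIntegral.integral_smul] at hintegral
    rw [← hintegral, smul_smul, inv_mul_cancel₀ h0, one_smul]

end LocalFlow

/-! ### Vector fields and integral curves in charts. -/

section Charts

theorem hasDerivAt_of_comp_smulRight {E F : Type*} [NormedAddCommGroup E] [NormedSpace ℂ E]
    [NormedAddCommGroup F] [NormedSpace ℂ F] {g : ℂ → F} {A : E →L[ℂ] F} {v : E} {t : ℂ}
    (h : HasFDerivAt g (A.comp ((1 : ℂ →L[ℂ] ℂ).smulRight v)) t) : HasDerivAt g (A v) t := by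
  simpa using h.hasDerivAt

theorem contMDiffAt_prod_of_contDiffAt {E F G : Type*} [NormedAddCommGroup E] [NormedSpace ℂ E]
    [NormedAddCommGroup F] [NormedSpace ℂ F] [NormedAddCommGroup G] [NormedSpace ℂ G]
    {c : E × F → G} {p : E × F} (h : ContDiffAt ℂ ω c p) :
    ContMDiffAt (𝓘(ℂ, E).prod 𝓘(ℂ, F)) 𝓘(ℂ, G) ω c p := by
  have h' := h.contMDiffAt
  rwa [modelWithCornersSelf_prod, ← chartedSpaceSelf_prod] at h'

variable {E : Type*} [NormedAddCommGroup E] [NormedSpace ℂ E]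
  {X : Type*} [TopologicalSpace X] [ChartedSpace E X] [IsManifold 𝓘(ℂ, E) ω X]

theorem contMDiffAt_chart_symm {x₀ : X} {y : E} (hy : y ∈ (extChartAt 𝓘(ℂ, E) x₀).target) :
    ContMDiffAt 𝓘(ℂ, E) 𝓘(ℂ, E) ω (extChartAt 𝓘(ℂ, E) x₀).symm y :=
  (contMDiffOn_extChartAt_symm x₀).contMDiffAt ((isOpen_extChartAt_target x₀).mem_nhds hy)

theorem contMDiffAt_chart {x₀ x : X} (hx : x ∈ (extChartAt 𝓘(ℂ, E) x₀).source) :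
    ContMDiffAt 𝓘(ℂ, E) 𝓘(ℂ, E) ω (extChartAt 𝓘(ℂ, E) x₀) x :=
  contMDiffAt_extChartAt' (by rwa [extChartAt_source] at hx)

theorem mfderiv_chart_comp_symm {x₀ : X} {y : E} (hy : y ∈ (extChartAt 𝓘(ℂ, E) x₀).target) :
    (mfderiv 𝓘(ℂ, E) 𝓘(ℂ, E) (extChartAt 𝓘(ℂ, E) x₀) ((extChartAt 𝓘(ℂ, E) x₀).symm y)) ∘L
      (mfderiv 𝓘(ℂ, E) 𝓘(ℂ, E) (extChartAt 𝓘(ℂ, E) x₀).symm y) = ContinuousLinearMap.id _ _ := by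
  have h := mfderiv_extChartAt_comp_mfderivWithin_extChartAt_symm (I := 𝓘(ℂ, E)) hy
  rwa [ModelWithCorners.range_eq_univ, mfderivWithin_univ] at h

theorem mfderiv_symm_comp_chart {x₀ : X} {y : E} (hy : y ∈ (extChartAt 𝓘(ℂ, E) x₀).target) :
    (mfderiv 𝓘(ℂ, E) 𝓘(ℂ, E) (extChartAt 𝓘(ℂ, E) x₀).symm y) ∘L
      (mfderiv 𝓘(ℂ, E) 𝓘(ℂ, E) (extChartAt 𝓘(ℂ, E) x₀) ((extChartAt 𝓘(ℂ, E) x₀).symm y)) =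
        ContinuousLinearMap.id _ _ := by
  have h := mfderivWithin_extChartAt_symm_comp_mfderiv_extChartAt (I := 𝓘(ℂ, E)) hy
  rwa [ModelWithCorners.range_eq_univ, mfderivWithin_univ] at h

theorem isInvertible_mfderiv_chart_symm {x₀ : X} {y : E}
    (hy : y ∈ (extChartAt 𝓘(ℂ, E) x₀).target) :
    (mfderiv 𝓘(ℂ, E) 𝓘(ℂ, E) (extChartAt 𝓘(ℂ, E) x₀).symm y).IsInvertible :=
  ContinuousLinearMap.IsInvertible.of_inverse (mfderiv_symm_comp_chart hy)
    (mfderiv_chart_comp_symm hy)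

theorem VField.inChart_of_mem {Θ : VField E X} {x₀ : X} {y : E}
    (hy : y ∈ (extChartAt 𝓘(ℂ, E) x₀).target) :
    Θ.inChart x₀ y = mfderiv 𝓘(ℂ, E) 𝓘(ℂ, E) (extChartAt 𝓘(ℂ, E) x₀)
      ((extChartAt 𝓘(ℂ, E) x₀).symm y) (Θ ((extChartAt 𝓘(ℂ, E) x₀).symm y)) := by
  rw [VField.inChart, VectorField.mpullback_apply,
    ContinuousLinearMap.inverse_eq (mfderiv_symm_comp_chart hy) (mfderiv_chart_comp_symm hy)]
  rfl

theorem VField.inChart_chart {Θ : VField E X} {x₀ x : X}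
    (hx : x ∈ (extChartAt 𝓘(ℂ, E) x₀).source) :
    Θ.inChart x₀ (extChartAt 𝓘(ℂ, E) x₀ x) =
      mfderiv 𝓘(ℂ, E) 𝓘(ℂ, E) (extChartAt 𝓘(ℂ, E) x₀) x (Θ x) := by
  rw [VField.inChart_of_mem ((extChartAt 𝓘(ℂ, E) x₀).map_source hx),
    (extChartAt 𝓘(ℂ, E) x₀).left_inv hx]

theorem IsHolField.contDiffAt_inChart [CompleteSpace E] {Θ : VField E X} (hΘ : IsHolField Θ)
    {x₀ : X} {y : E} (hy : y ∈ (extChartAt 𝓘(ℂ, E) x₀).target) :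
    ContDiffAt ℂ ω (Θ.inChart x₀) y :=
  contMDiffAt_vectorSpace_iff_contDiffAt.1
    (ContMDiffAt.mpullback_vectorField_preimage (n := ω) (hΘ _) (contMDiffAt_chart_symm hy)
      (isInvertible_mfderiv_chart_symm hy) (by simp))

theorem hasDerivAt_chart_comp {Θ : VField E X} {γ : ℂ → X} {t : ℂ}
    (hγ : HasMFDerivAt 𝓘(ℂ, ℂ) 𝓘(ℂ, E) γ t ((1 : ℂ →L[ℂ] ℂ).smulRight (Θ (γ t))))
    {x₀ : X} (hx : γ t ∈ (extChartAt 𝓘(ℂ, E) x₀).source) :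
    HasDerivAt (fun s => extChartAt 𝓘(ℂ, E) x₀ (γ s))
      (Θ.inChart x₀ (extChartAt 𝓘(ℂ, E) x₀ (γ t))) t := by
  have h1 := ((contMDiffAt_chart hx).mdifferentiableAt (by simp)).hasMFDerivAt
  have h2 : HasFDerivAt (fun s => extChartAt 𝓘(ℂ, E) x₀ (γ s))
      ((show E →L[ℂ] E from mfderiv 𝓘(ℂ, E) 𝓘(ℂ, E) (extChartAt 𝓘(ℂ, E) x₀) (γ t)).comp
        ((1 : ℂ →L[ℂ] ℂ).smulRight (show E from Θ (γ t)))) t := (h1.comp t hγ).hasFDerivAt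
  rw [VField.inChart_chart hx]
  exact hasDerivAt_of_comp_smulRight (E := E) (F := E) h2

end Charts

/-! ### Uniqueness of integral curves. -/

section Uniqueness

/-- An analytic field is locally Lipschitz, so real ODE uniqueness applies to the field `s • V`. -/
theorem eventuallyEq_of_hasDerivAt {E : Type*} [NormedAddCommGroup E] [NormedSpace ℂ E]
    {V : E → E} {a b : ℝ → E} {s : ℂ} {r : ℝ} (hV : ContDiffAt ℂ ω V (a r))
    (ha : ∀ᶠ r' in 𝓝 r, HasDerivAt a (s • V (a r')) r')
    (hb : ∀ᶠ r' in 𝓝 r, HasDerivAt b (s • V (b r')) r') (h : a r = b r) : a =ᶠ[𝓝 r] b := by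
  have hV' : ContDiffAt ℂ 1 (fun y => s • V y) (a r) := contDiffAt_const.smul (hV.of_le (by simp))
  obtain ⟨K, t, ht, hK⟩ := hV'.exists_lipschitzOnWith
  have hat := ha.self_of_nhds.continuousAt.eventually_mem ht
  have hbt := hb.self_of_nhds.continuousAt.eventually_mem (h ▸ ht)
  exact ODE_solution_unique_of_eventually (v := fun _ y => s • V y) (s := fun _ => t) (K := K)
    (Eventually.of_forall fun _ => hK) (ha.and hat) (hb.and hbt) h

variable {E : Type*} [NormedAddCommGroup E] [NormedSpace ℂ E] [CompleteSpace E]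
  {X : Type*} [TopologicalSpace X] [ChartedSpace E X] [IsManifold 𝓘(ℂ, E) ω X] [T2Space X]

/-- Uniqueness of integral curves along the real line through `0` in the direction `s`. -/
theorem eqOn_of_integralCurve {Θ : VField E X} (hΘ : IsHolField Θ) {γ : ℂ → X}
    (hγ : ∀ t : ℂ, HasMFDerivAt 𝓘(ℂ, ℂ) 𝓘(ℂ, E) γ t ((1 : ℂ →L[ℂ] ℂ).smulRight (Θ (γ t))))
    {s : ℂ} {β : ℝ → X} {a b r₀ : ℝ} (hr₀ : r₀ ∈ Ioo a b)
    (hβc : ∀ r ∈ Ioo a b, ContinuousAt β r)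
    (hβ : ∀ r ∈ Ioo a b, ∃ x₀ : X, ∀ᶠ r' : ℝ in 𝓝 r, β r' ∈ (extChartAt 𝓘(ℂ, E) x₀).source ∧
      HasDerivAt (fun r => extChartAt 𝓘(ℂ, E) x₀ (β r))
        (s • Θ.inChart x₀ (extChartAt 𝓘(ℂ, E) x₀ (β r'))) r')
    (h0 : γ (r₀ * s) = β r₀) : ∀ r ∈ Ioo a b, γ (r * s) = β r := by
  have hline : ∀ r : ℝ, HasDerivAt (fun r : ℝ => (r : ℂ) * s) s r := fun r => by
    simpa using (Complex.ofRealCLM.hasDerivAt (x := r)).mul_const s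
  have hαc : ∀ r : ℝ, ContinuousAt (fun r : ℝ => γ (r * s)) r := fun r =>
    ContinuousAt.comp (g := γ) (hγ _).continuousAt (hline r).continuousAt
  have hloc : ∀ r ∈ Ioo a b, γ (r * s) = β r → ∀ᶠ r' : ℝ in 𝓝 r, γ (r' * s) = β r' := by
    intro r hr hrr
    obtain ⟨x₀, hx₀⟩ := hβ r hr
    have hsrc : β r ∈ (extChartAt 𝓘(ℂ, E) x₀).source := hx₀.self_of_nhds.1
    have hαs : ∀ᶠ r' : ℝ in 𝓝 r, γ (r' * s) ∈ (extChartAt 𝓘(ℂ, E) x₀).source := by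
      refine (hαc r).eventually_mem ?_
      rw [hrr]
      exact (isOpen_extChartAt_source x₀).mem_nhds hsrc
    have hαd : ∀ᶠ r' : ℝ in 𝓝 r, HasDerivAt (fun r : ℝ => extChartAt 𝓘(ℂ, E) x₀ (γ (r * s)))
        (s • Θ.inChart x₀ (extChartAt 𝓘(ℂ, E) x₀ (γ (r' * s)))) r' := by
      filter_upwards [hαs] with r' h
      exact (hasDerivAt_chart_comp (hγ _) h).scomp r' (hline r')
    have hV : ContDiffAt ℂ ω (Θ.inChart x₀) (extChartAt 𝓘(ℂ, E) x₀ (γ (r * s))) := by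
      refine hΘ.contDiffAt_inChart ((extChartAt 𝓘(ℂ, E) x₀).map_source ?_)
      rwa [hrr]
    have heq := eventuallyEq_of_hasDerivAt hV hαd (hx₀.mono fun _ h => h.2) (by rw [hrr])
    filter_upwards [heq, hαs, hx₀] with r' h1 h2 h3
    exact (extChartAt 𝓘(ℂ, E) x₀).injOn h2 h3.1 h1
  -- Continuation argument: the set of times near which the curves agree is open by definition. It
  -- is relatively closed in the interval because curves that agree at times accumulating at `r`
  -- agree at `r` (Hausdorff), hence near `r` by `hloc`.
  let u : Set ℝ := {r | ∀ᶠ r' : ℝ in 𝓝 r, γ (r' * s) = β r'}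
  have hu : IsOpen u := isOpen_setOfPred_eventually_nhds
  have hsub : Ioo a b ⊆ u := by
    refine isPreconnected_Ioo.subset_of_closure_inter_subset hu ⟨r₀, hr₀, hloc r₀ hr₀ h0⟩ ?_
    rintro r ⟨hr, hrab⟩
    refine hloc r hrab ?_
    by_contra hne
    have h1 : ∀ᶠ r' : ℝ in 𝓝 r, γ (r' * s) ≠ β r' :=
      ((hαc r).prodMk (hβc r hrab)).eventually_mem
        (isClosed_diagonal.isOpen_compl.mem_nhds hne)
    obtain ⟨r', h2, h3⟩ := ((mem_closure_iff_frequently.1 hr).and_eventually h1).exists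
    exact h3 h2.self_of_nhds
  exact fun r hr => (hsub hr).self_of_nhds

/-- Every complex time `t` lies on the real line through 0 in the direction `t`, so real uniqueness
along these lines suffices. -/
theorem integralCurve_unique {Θ : VField E X} (hΘ : IsHolField Θ) {γ γ' : ℂ → X}
    (hγ : ∀ t : ℂ, HasMFDerivAt 𝓘(ℂ, ℂ) 𝓘(ℂ, E) γ t ((1 : ℂ →L[ℂ] ℂ).smulRight (Θ (γ t))))
    (hγ' : ∀ t : ℂ, HasMFDerivAt 𝓘(ℂ, ℂ) 𝓘(ℂ, E) γ' t ((1 : ℂ →L[ℂ] ℂ).smulRight (Θ (γ' t))))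
    (h0 : γ 0 = γ' 0) : γ = γ' := by
  ext t
  have hline : ∀ r : ℝ, HasDerivAt (fun r : ℝ => (r : ℂ) * t) t r := fun r => by
    simpa using (Complex.ofRealCLM.hasDerivAt (x := r)).mul_const t
  have hc : ∀ r : ℝ, ContinuousAt (fun r : ℝ => γ' (r * t)) r := fun r =>
    ContinuousAt.comp (g := γ') (hγ' _).continuousAt (hline r).continuousAt
  have h := eqOn_of_integralCurve (β := fun r => γ' (r * t)) (a := -2) (b := 2) (r₀ := 0) (s := t)
    hΘ hγ (by constructor <;> norm_num) (fun r _ => hc r) (fun r _ => ⟨γ' (r * t), ?_⟩)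
    (by simpa using h0) 1 (by constructor <;> norm_num)
  · simpa using h
  · filter_upwards [(hc r).eventually_mem (extChartAt_source_mem_nhds (I := 𝓘(ℂ, E)) _)] with r' h
    have hd := (hasDerivAt_chart_comp (hγ' (r' * t)) h).scomp r' (hline r')
    exact ⟨h, hd⟩

end Uniqueness

/-! ### The holomorphic flow of a complete field. -/

section Flow

variable {E : Type*} [NormedAddCommGroup E] [NormedSpace ℂ E]
  {X : Type*} [TopologicalSpace X] [ChartedSpace E X]

/-- A holomorphic flow, i.e. a holomorphic action of the additive group `ℂ` on `X`. -/
structure IsHolFlow (E : Type*) [NormedAddCommGroup E] [NormedSpace ℂ E]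
    {X : Type*} [TopologicalSpace X] [ChartedSpace E X] (φ : ℂ → X → X) : Prop where
  zero : ∀ x, φ 0 x = x
  add : ∀ s t x, φ (s + t) x = φ s (φ t x)
  contMDiff : ContMDiff (𝓘(ℂ, ℂ).prod 𝓘(ℂ, E)) 𝓘(ℂ, E) ω fun p : ℂ × X => φ p.1 p.2

variable [IsManifold 𝓘(ℂ, E) ω X] [CompleteSpace E] [T2Space X]

/-- In a chart, uniqueness along the segment from 0 to `s` identifies the given global curves with
the local solution, which is analytic in time and initial value. -/
theorem contMDiffAt_integralCurves_zero {Θ : VField E X} (hΘ : IsHolField Θ) {φ : ℂ → X → X}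
    (h0 : ∀ x, φ 0 x = x)
    (hφ : ∀ x t, HasMFDerivAt 𝓘(ℂ, ℂ) 𝓘(ℂ, E) (fun s => φ s x) t
      ((1 : ℂ →L[ℂ] ℂ).smulRight (Θ (φ t x)))) (x₀ : X) :
    ContMDiffAt (𝓘(ℂ, ℂ).prod 𝓘(ℂ, E)) 𝓘(ℂ, E) ω (fun p : ℂ × X => φ p.1 p.2) (0, x₀) := by
  set e := extChartAt 𝓘(ℂ, E) x₀ with he
  have hy₀ : e x₀ ∈ e.target := mem_extChartAt_target x₀
  obtain ⟨c, hc, hsol⟩ := exists_contDiffAt_solution (hΘ.contDiffAt_inChart hy₀)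
  obtain ⟨δ, hδ, hball⟩ := Metric.isOpen_iff.1 (isOpen_extChartAt_target (I := 𝓘(ℂ, E)) x₀) _ hy₀
  have hev : ∀ᶠ p in 𝓝 ((0 : ℂ), e x₀), φ p.1 (e.symm p.2) = e.symm (c p) ∧ c p ∈ e.target := by
    filter_upwards [hsol δ hδ] with p hp
    obtain ⟨γ, hγ0, hγ1, hγ⟩ := hp
    have htar : ∀ r ∈ Ioo (-2 : ℝ) 2, γ r ∈ e.target := fun r hr => hball (hγ r hr).1
    have hmem : ∀ r ∈ Ioo (-2 : ℝ) 2, Ioo (-2 : ℝ) 2 ∈ 𝓝 r := fun r hr => Ioo_mem_nhds hr.1 hr.2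
    have h := eqOn_of_integralCurve (β := fun r => e.symm (γ r)) (a := -2) (b := 2) (r₀ := 0)
      (s := p.1) hΘ (hφ (e.symm p.2)) (by constructor <;> norm_num) ?_ ?_ (by simp [h0, hγ0])
      1 (by constructor <;> norm_num)
    · rw [← hγ1]
      exact ⟨by simpa using h, htar 1 (by constructor <;> norm_num)⟩
    · intro r hr
      exact ContinuousAt.comp (g := e.symm)
        (contMDiffAt_chart_symm (htar r hr)).continuousAt (hγ r hr).2.continuousAt
    · intro r hr
      refine ⟨x₀, ?_⟩
      filter_upwards [hmem r hr] with r' hr'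
      refine ⟨e.map_target (htar r' hr'), ?_⟩
      rw [e.right_inv (htar r' hr')]
      refine (hγ r' hr').2.congr_of_eventuallyEq ?_
      filter_upwards [hmem r' hr'] with z hz
      exact e.right_inv (htar z hz)
  have hct : c (0, e x₀) ∈ e.target := hev.self_of_nhds.2
  have hchart : ContMDiffAt (𝓘(ℂ, ℂ).prod 𝓘(ℂ, E)) (𝓘(ℂ, ℂ).prod 𝓘(ℂ, E)) ω
      (fun p : ℂ × X => (p.1, e p.2)) (0, x₀) :=
    contMDiffAt_fst.prodMk ((contMDiffAt_chart (mem_extChartAt_source x₀)).comp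
      ((0 : ℂ), x₀) contMDiffAt_snd)
  have hc' := contMDiffAt_prod_of_contDiffAt hc
  have hcomp : ContMDiffAt (𝓘(ℂ, ℂ).prod 𝓘(ℂ, E)) 𝓘(ℂ, E) ω
      (fun p : ℂ × X => e.symm (c (p.1, e p.2))) (0, x₀) :=
    ContMDiffAt.comp ((0 : ℂ), x₀) (g := e.symm) (f := fun p : ℂ × X => c (p.1, e p.2))
      (contMDiffAt_chart_symm hct) (ContMDiffAt.comp ((0 : ℂ), x₀) (g := c) hc' hchart)
  refine hcomp.congr_of_eventuallyEq ?_
  have hsrc : ∀ᶠ p : ℂ × X in 𝓝 (0, x₀), p.2 ∈ e.source :=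
    continuousAt_snd.eventually_mem (extChartAt_source_mem_nhds (I := 𝓘(ℂ, E)) x₀)
  filter_upwards [hchart.continuousAt.eventually hev, hsrc] with p h1 h2
  have h3 := h1.1
  simp only [e.left_inv h2] at h3
  exact h3

/-- A complete holomorphic vector field generates a holomorphic flow. -/
theorem IsCompleteField.exists_flow {Θ : VField E X} (hΘ : IsCompleteField Θ) :
    ∃ φ : ℂ → X → X, IsHolFlow E φ ∧ ∀ x t, HasMFDerivAt 𝓘(ℂ, ℂ) 𝓘(ℂ, E) (fun s => φ s x) t
      ((1 : ℂ →L[ℂ] ℂ).smulRight (Θ (φ t x))) := by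
  obtain ⟨hhol, hcomplete⟩ := hΘ
  choose γ hγ0 hγ using hcomplete
  have hadd : ∀ s t x, γ x (s + t) = γ (γ x t) s := by
    intro s t x
    have h1 : ∀ s : ℂ, HasMFDerivAt 𝓘(ℂ, ℂ) 𝓘(ℂ, E) (fun s => γ x (s + t)) s
        ((1 : ℂ →L[ℂ] ℂ).smulRight (Θ (γ x (s + t)))) := by
      intro s
      have h2 : HasMFDerivAt 𝓘(ℂ, ℂ) 𝓘(ℂ, ℂ) (fun s : ℂ => s + t) s (1 : ℂ →L[ℂ] ℂ) :=
        ((hasFDerivAt_id s).add_const t).hasMFDerivAt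
      exact HasMFDerivAt.comp s (hγ x (s + t)) h2
    exact congrFun (integralCurve_unique hhol h1 (hγ (γ x t)) (by simp [hγ0])) s
  refine ⟨fun t x => γ x t, ⟨hγ0, hadd, ?_⟩, hγ⟩
  have hzero := contMDiffAt_integralCurves_zero hhol (φ := fun t x => γ x t) hγ0 hγ
  rintro ⟨t, x⟩
  -- Joint holomorphy spreads from time 0 along ℂ by connectedness. If `t` is a limit of good times,
  -- a good time `t₁` close to `t` is chosen and φ_t is written as φ_{t - t₁} ∘ φ_{t₁}; the first
  -- factor is holomorphic because (t - t₁, φ_{t₁}(x)) is close to (0, φ_t(x)).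
  let u : Set ℂ := {t | ContMDiffAt (𝓘(ℂ, ℂ).prod 𝓘(ℂ, E)) 𝓘(ℂ, E) ω
    (fun p : ℂ × X => γ p.2 p.1) (t, x)}
  have hu : IsOpen u := by
    rw [isOpen_iff_mem_nhds]
    intro t ht
    have h1 := (contMDiffAt_iff_contMDiffAt_nhds (by simp)).1 ht
    exact (Continuous.prodMk_left x).continuousAt.eventually h1
  have huniv : (univ : Set ℂ) ⊆ u := by
    refine isPreconnected_univ.subset_of_closure_inter_subset hu ⟨0, trivial, hzero x⟩ ?_
    rintro t ⟨ht, -⟩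
    have h1 := (contMDiffAt_iff_contMDiffAt_nhds (by simp)).1 (hzero (γ x t))
    have h2 : ContinuousAt (fun t₁ => (t - t₁, γ x t₁)) t :=
      (continuousAt_const.sub continuousAt_id).prodMk (hγ x t).continuousAt
    have h3 : Tendsto (fun t₁ => (t - t₁, γ x t₁)) (𝓝 t) (𝓝 (0, γ x t)) := by
      have := h2.tendsto
      rwa [sub_self] at this
    obtain ⟨t₁, ht₁, h4⟩ :=
      ((mem_closure_iff_frequently.1 ht).and_eventually (h3.eventually h1)).exists
    have h5 : ContMDiffAt (𝓘(ℂ, ℂ).prod 𝓘(ℂ, E)) 𝓘(ℂ, E) ω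
        (fun p : ℂ × X => γ p.2 t₁) (t, x) :=
      ContMDiffAt.comp (t, x) (g := fun p : ℂ × X => γ p.2 p.1)
        (f := fun p : ℂ × X => (t₁, p.2)) ht₁ (contMDiffAt_const.prodMk contMDiffAt_snd)
    have h6 : ContMDiffAt (𝓘(ℂ, ℂ).prod 𝓘(ℂ, E)) 𝓘(ℂ, ℂ) ω
        (fun p : ℂ × X => p.1 - t₁) (t, x) :=
      ContMDiffAt.sub contMDiffAt_fst contMDiffAt_const
    have h7 := ContMDiffAt.comp (t, x) (g := fun p : ℂ × X => γ p.2 p.1)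
      (f := fun p : ℂ × X => (p.1 - t₁, γ p.2 t₁)) h4 (h6.prodMk h5)
    refine h7.congr_of_eventuallyEq (Eventually.of_forall fun p => ?_)
    simp only [Function.comp]
    rw [← hadd, sub_add_cancel]
  exact huniv (mem_univ t)

end Flow

/-! ### Compositions of several flows. -/

section FlowComp

variable {X : Type*}

/-- The composition of the flows `φ i` at the times `t i`, for `i` in a list. -/
def flowComp {ι : Type*} (φ : ι → ℂ → X → X) (l : List ι) (t : ι → ℂ) (x : X) : X :=
  l.foldr (fun i z => φ i (t i) z) x

theorem flowComp_single_of_notMem {ι : Type*} [DecidableEq ι] {φ : ι → ℂ → X → X}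
    (hφ : ∀ i x, φ i 0 x = x) {l : List ι} {i : ι} (hi : i ∉ l) (s : ℂ) (x : X) :
    flowComp φ l (Pi.single i s) x = x := by
  induction l with
  | nil => rfl
  | cons j l ih =>
    rw [List.mem_cons, not_or] at hi
    have h1 : (Pi.single i s : ι → ℂ) j = 0 := Pi.single_eq_of_ne (Ne.symm hi.1) _
    change φ j _ (flowComp φ l _ x) = x
    rw [h1, hφ, ih hi.2]

/-- Along a coordinate axis only one flow moves, so the partial derivatives of the composition at
time 0 are the individual velocities. -/
theorem flowComp_single {ι : Type*} [DecidableEq ι] {φ : ι → ℂ → X → X}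
    (hφ : ∀ i x, φ i 0 x = x) {l : List ι} (hl : l.Nodup) {i : ι} (hi : i ∈ l) (s : ℂ) (x : X) :
    flowComp φ l (Pi.single i s) x = φ i s x := by
  induction l with
  | nil => simp at hi
  | cons j l ih =>
    rw [List.nodup_cons] at hl
    change φ j _ (flowComp φ l _ x) = _
    rcases eq_or_ne i j with rfl | hij
    · rw [flowComp_single_of_notMem hφ hl.1, Pi.single_eq_same]
    · have h1 : (Pi.single i s : ι → ℂ) j = 0 := Pi.single_eq_of_ne (Ne.symm hij) _
      rw [h1, hφ, ih hl.2 ((List.mem_cons.1 hi).resolve_left hij)]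

end FlowComp

/-! ### Transitivity from spanning velocities. -/

section Transitivity

variable {E : Type*} [NormedAddCommGroup E] [NormedSpace ℂ E]
  {X : Type*} [TopologicalSpace X] [ChartedSpace E X]

variable (E) in
/-- The velocity of a flow at time zero. -/
noncomputable def flowVelocity (φ : ℂ → X → X) (x : X) : E :=
  mfderiv 𝓘(ℂ, ℂ) 𝓘(ℂ, E) (fun s => φ s x) 0 (1 : ℂ)

theorem IsHolFlow.contMDiff_time {φ : ℂ → X → X} (hφ : IsHolFlow E φ) (x : X) :
    ContMDiff 𝓘(ℂ, ℂ) 𝓘(ℂ, E) ω fun s => φ s x :=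
  ContMDiff.comp (g := fun p : ℂ × X => φ p.1 p.2) (f := fun s : ℂ => (s, x)) hφ.contMDiff
    (contMDiff_id.prodMk contMDiff_const)

theorem IsHolFlow.contMDiff_space {φ : ℂ → X → X} (hφ : IsHolFlow E φ) (t : ℂ) :
    ContMDiff 𝓘(ℂ, E) 𝓘(ℂ, E) ω (φ t) :=
  ContMDiff.comp (g := fun p : ℂ × X => φ p.1 p.2) (f := fun x : X => (t, x)) hφ.contMDiff
    (contMDiff_const.prodMk contMDiff_id)

theorem IsHolFlow.hasDerivAt_comp {φ : ℂ → X → X} (hφ : IsHolFlow E φ) {F : Type*}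
    [NormedAddCommGroup F] [NormedSpace ℂ F] {g : X → F} {x : X} {A : E →L[ℂ] F}
    (hg : HasMFDerivAt 𝓘(ℂ, E) 𝓘(ℂ, F) g x A) :
    HasDerivAt (fun s => g (φ s x)) (A (flowVelocity E φ x)) 0 := by
  have h1 := ((hφ.contMDiff_time x).mdifferentiableAt (by simp) (x := (0 : ℂ))).hasMFDerivAt
  have h2 : HasMFDerivAt 𝓘(ℂ, E) 𝓘(ℂ, F) g (φ 0 x) A := by rwa [hφ.zero x]
  have h3 : HasFDerivAt (fun s => g (φ s x)) (A.comp (show ℂ →L[ℂ] E from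
      mfderiv 𝓘(ℂ, ℂ) 𝓘(ℂ, E) (fun s => φ s x) 0)) 0 :=
    (HasMFDerivAt.comp (0 : ℂ) h2 h1).hasFDerivAt
  exact h3.hasDerivAt

theorem contMDiff_flowComp {ι : Type*} [Fintype ι] {φ : ι → ℂ → X → X}
    (hφ : ∀ i, IsHolFlow E (φ i)) (l : List ι) (x : X) :
    ContMDiff 𝓘(ℂ, ι → ℂ) 𝓘(ℂ, E) ω fun t => flowComp φ l t x := by
  induction l with
  | nil => exact contMDiff_const
  | cons i l ih =>
    have h1 : ContMDiff 𝓘(ℂ, ι → ℂ) 𝓘(ℂ, ℂ) ω fun t : ι → ℂ => t i :=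
      (contDiff_apply ℂ ℂ i).contMDiff
    exact ContMDiff.comp (g := fun p : ℂ × X => φ i p.1 p.2)
      (f := fun t : ι → ℂ => (t i, flowComp φ l t x)) (hφ i).contMDiff (h1.prodMk ih)

variable [IsManifold 𝓘(ℂ, E) ω X]

/-- If the velocities of a family of flows span the tangent space at `x`, then every equivalence
relation which is invariant under these flows has a neighbourhood of `x` in one class. -/
theorem mem_nhds_of_span_flowVelocity [FiniteDimensional ℂ E] {𝓕 : Set (ℂ → X → X)}
    (h𝓕 : ∀ φ ∈ 𝓕, IsHolFlow E φ) {R : X → X → Prop} (hR : Equivalence R)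
    (hflow : ∀ φ ∈ 𝓕, ∀ t x, R x (φ t x)) {x : X}
    (hspan : Submodule.span ℂ {ξ : E | ∃ φ ∈ 𝓕, flowVelocity E φ x = ξ} = ⊤) :
    {y | R x y} ∈ 𝓝 x := by
  have : CompleteSpace E := FiniteDimensional.complete ℂ E
  obtain ⟨ξ, hξ, hξspan, -⟩ := Submodule.exists_fun_fin_finrank_span_eq ℂ
    {ξ : E | ∃ φ ∈ 𝓕, flowVelocity E φ x = ξ}
  generalize Module.finrank ℂ (Submodule.span ℂ {ξ : E | ∃ φ ∈ 𝓕, flowVelocity E φ x = ξ}) = n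
    at ξ hξ hξspan
  choose φ hφ𝓕 hφξ using hξ
  have hφ : ∀ i, IsHolFlow E (φ i) := fun i => h𝓕 _ (hφ𝓕 i)
  -- `Ψ` stays in the class of `x` and its derivative at 0 has the spanning velocities as columns.
  -- It is therefore a submersion at 0, and its image contains a neighbourhood of `x`.
  set Ψ : (Fin n → ℂ) → X := fun t => flowComp φ (List.finRange n) t x with hΨ
  have hΨc : ContMDiff 𝓘(ℂ, Fin n → ℂ) 𝓘(ℂ, E) ω Ψ := contMDiff_flowComp hφ _ x
  have hΨs : ∀ i s, Ψ (Pi.single i s) = φ i s x := fun i s =>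
    flowComp_single (fun i => (hφ i).zero) (List.nodup_finRange n) (List.mem_finRange i) s x
  have hΨR : ∀ t, R x (Ψ t) := by
    intro t
    have h : ∀ l : List (Fin n), R x (flowComp φ l t x) := by
      intro l
      induction l with
      | nil => exact hR.refl x
      | cons i l ih => exact hR.trans ih (hflow _ (hφ𝓕 i) _ _)
    exact h _
  have hΨ0 : Ψ 0 = x := by
    have h : ∀ l : List (Fin n), flowComp φ l 0 x = x := by
      intro l
      induction l with
      | nil => rfl
      | cons i l ih =>
        change φ i 0 (flowComp φ l 0 x) = x
        rw [ih, (hφ i).zero]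
    exact h _
  set e := extChartAt 𝓘(ℂ, E) x with he
  have hxs : x ∈ e.source := mem_extChartAt_source x
  let A : E →L[ℂ] E := mfderiv 𝓘(ℂ, E) 𝓘(ℂ, E) e x
  have hA : HasMFDerivAt 𝓘(ℂ, E) 𝓘(ℂ, E) e x A :=
    ((contMDiffAt_chart hxs).mdifferentiableAt (by simp)).hasMFDerivAt
  have hAsurj : Function.Surjective A := by
    obtain ⟨B, hB⟩ := isInvertible_mfderiv_extChartAt (I := 𝓘(ℂ, E)) hxs
    intro v
    refine ⟨B.symm v, ?_⟩
    change mfderiv 𝓘(ℂ, E) 𝓘(ℂ, E) e x (B.symm v) = v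
    rw [← hB]
    exact B.apply_symm_apply v
  have hg : ContDiffAt ℂ ω (fun t => e (Ψ t)) 0 := by
    have h1 : ContMDiffAt 𝓘(ℂ, E) 𝓘(ℂ, E) ω e (Ψ 0) := by
      rw [hΨ0]
      exact contMDiffAt_chart hxs
    exact (ContMDiffAt.comp (0 : Fin n → ℂ) h1 (hΨc 0)).contDiffAt
  have hstrict := hg.hasStrictFDerivAt (by simp)
  have hrange : (fderiv ℂ (fun t => e (Ψ t)) 0).range = ⊤ := by
    have h1 : ∀ i, fderiv ℂ (fun t => e (Ψ t)) 0 (Pi.single i 1) = A (ξ i) := by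
      intro i
      have h2 : HasDerivAt (fun s : ℂ => (Pi.single i s : Fin n → ℂ)) (Pi.single i 1) 0 :=
        hasDerivAt_single i 0
      have h3 : HasFDerivAt (fun t => e (Ψ t)) (fderiv ℂ (fun t => e (Ψ t)) 0)
          (Pi.single i (0 : ℂ)) := by
        rw [Pi.single_zero]
        exact hstrict.hasFDerivAt
      have h4 := h3.comp_hasDerivAt (0 : ℂ) h2
      have h5 : ((fun t => e (Ψ t)) ∘ fun s : ℂ => (Pi.single i s : Fin n → ℂ))
          = fun s => e (φ i s x) := by
        ext s
        simp [hΨs]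
      rw [h5] at h4
      rw [← hφξ i]
      exact h4.unique ((hφ i).hasDerivAt_comp hA)
    rw [eq_top_iff]
    have h6 : Submodule.map (A : E →ₗ[ℂ] E) (Submodule.span ℂ (range ξ)) = ⊤ := by
      rw [hξspan, hspan, Submodule.map_top]
      exact LinearMap.range_eq_top.2 hAsurj
    rw [← h6, Submodule.map_span, Submodule.span_le]
    rintro _ ⟨_, ⟨i, rfl⟩, rfl⟩
    exact ⟨Pi.single i 1, h1 i⟩
  have hmap := hstrict.map_nhds_eq_of_surj hrange
  -- Times are restricted so that `Ψ t` stays in the chart domain, where equality of chart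
  -- coordinates gives equality of points.
  have hW : {t | Ψ t ∈ e.source} ∈ 𝓝 (0 : Fin n → ℂ) := by
    refine hΨc.continuous.continuousAt.eventually_mem ?_
    rw [hΨ0]
    exact extChartAt_source_mem_nhds x
  have himg := image_mem_map (m := fun t => e (Ψ t)) hW
  rw [hmap, hΨ0] at himg
  filter_upwards [extChartAt_source_mem_nhds (I := 𝓘(ℂ, E)) x,
    (contMDiffAt_chart hxs).continuousAt.eventually_mem himg] with y hy1 hy2
  obtain ⟨t, ht, hty⟩ := hy2
  have h7 : Ψ t = y := e.injOn ht hy1 hty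
  change R x y
  rw [← h7]
  exact hΨR t

/-- On a connected manifold, flows whose velocities span all tangent spaces act transitively. -/
theorem rel_of_span_flowVelocity [FiniteDimensional ℂ E] [ConnectedSpace X]
    {𝓕 : Set (ℂ → X → X)} (h𝓕 : ∀ φ ∈ 𝓕, IsHolFlow E φ) {R : X → X → Prop} (hR : Equivalence R)
    (hflow : ∀ φ ∈ 𝓕, ∀ t x, R x (φ t x))
    (hspan : ∀ x, Submodule.span ℂ {ξ : E | ∃ φ ∈ 𝓕, flowVelocity E φ x = ξ} = ⊤) (x y : X) :
    R x y := by
  have hnhds := fun x => mem_nhds_of_span_flowVelocity h𝓕 hR hflow (hspan x)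
  have hopen : IsOpen {y | R x y} := isOpen_iff_mem_nhds.2 fun y hy =>
    mem_of_superset (hnhds y) fun z hz => hR.trans hy hz
  have hclosed : IsClosed {y | R x y} := by
    rw [← isOpen_compl_iff, isOpen_iff_mem_nhds]
    exact fun y hy => mem_of_superset (hnhds y) fun z hz hxz => hy (hR.trans hxz (hR.symm hz))
  have huniv := IsClopen.eq_univ ⟨hclosed, hopen⟩ ⟨x, hR.refl x⟩
  exact huniv.ge (mem_univ y)

end Transitivity

/-! ### The Lie derivative as derivative of the pullback. -/

section Volume

/-- The pullback of a form under a local flow has derivative the Lie derivative at time zero. -/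
theorem hasDerivAt_pullback_lieDeriv {E : Type*} [NormedAddCommGroup E] [NormedSpace ℂ E] {k : ℕ}
    {β : E → E [⋀^Fin k]→L[ℂ] ℂ} {c : ℂ × E → E} {V : E → E} {y : E}
    (hβ : DifferentiableAt ℂ β y) (hc : ContDiffAt ℂ ω c (0, y)) (hc0 : ∀ᶠ z in 𝓝 y, c (0, z) = z)
    (hcV : ∀ᶠ z in 𝓝 y, HasDerivAt (fun s => c (s, z)) (V z) 0) (w : Fin k → E) :
    HasDerivAt (fun s => β (c (s, y)) fun i => fderiv ℂ (fun z => c (s, z)) y (w i))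
      (lieDeriv V β y w) 0 := by
  have hdc : DifferentiableAt ℂ (fderiv ℂ c) (0, y) :=
    (hc.fderiv_right (m := ω) (by simp)).differentiableAt (by simp)
  have hev : ∀ᶠ p in 𝓝 ((0 : ℂ), y), DifferentiableAt ℂ c p :=
    (hc.eventually (by simp)).mono fun p hp => hp.differentiableAt (by simp)
  have hleft : ContinuousAt (fun s : ℂ => (s, y)) 0 := by fun_prop
  have hright : ContinuousAt (fun z : E => ((0 : ℂ), z)) y := by fun_prop
  have hspace : ∀ᶠ s in 𝓝 (0 : ℂ), ∀ v, fderiv ℂ (fun z => c (s, z)) y v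
      = fderiv ℂ c (s, y) (0, v) := by
    filter_upwards [hleft.eventually hev] with s hs v
    have h1 := hs.hasFDerivAt.comp y (hasFDerivAt_prodMk_right s y)
    have h2 : fderiv ℂ (fun z => c (s, z)) y = _ := h1.fderiv
    rw [h2]
    simp
  have htime : ∀ᶠ z in 𝓝 y, fderiv ℂ c (0, z) (1, 0) = V z := by
    filter_upwards [hright.eventually hev, hcV] with z h1 h2
    have h3 := h1.hasFDerivAt.comp_hasDerivAt (0 : ℂ)
      ((hasDerivAt_id (0 : ℂ)).prodMk (hasDerivAt_const (0 : ℂ) z))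
    exact h3.unique h2
  -- The derivative of `V` is the mixed derivative of `c`, taken first in time and then in space.
  -- Differentiating the space derivative of `c` in time gives the opposite order, which agrees by
  -- symmetry of second derivatives.
  have hfV : ∀ v, fderiv ℂ V y v = fderiv ℂ (fderiv ℂ c) (0, y) (0, v) (1, 0) := by
    intro v
    have h1 : HasFDerivAt (fun z => fderiv ℂ c (0, z))
        ((fderiv ℂ (fderiv ℂ c) (0, y)).comp (.inr ℂ ℂ E)) y :=
      hdc.hasFDerivAt.comp y (hasFDerivAt_prodMk_right (0 : ℂ) y)
    have h2 := h1.clm_apply (hasFDerivAt_const ((1 : ℂ), (0 : E)) y)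
    have h3 : HasFDerivAt V _ y := h2.congr_of_eventuallyEq (htime.mono fun z hz => hz.symm)
    rw [h3.fderiv]
    simp
  have hsymm := hc.isSymmSndFDerivAt_of_omega
  have hc00 : c (0, y) = y := hc0.self_of_nhds
  have hctime : HasDerivAt (fun s => c (s, y)) (V y) 0 := hcV.self_of_nhds
  have hβc : HasFDerivAt (fun s => β (c (s, y)))
      ((fderiv ℂ β y).comp (ContinuousLinearMap.toSpanSingleton ℂ (V y))) 0 := by
    have h1 : HasFDerivAt β (fderiv ℂ β y) (c (0, y)) := by
      rw [hc00]
      exact hβ.hasFDerivAt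
    exact h1.comp (0 : ℂ) hctime.hasFDerivAt
  have hM : ∀ i, HasFDerivAt (fun s => fderiv ℂ (fun z => c (s, z)) y (w i))
      (ContinuousLinearMap.toSpanSingleton ℂ (fderiv ℂ V y (w i))) 0 := by
    intro i
    have h1 : HasDerivAt (fun s => fderiv ℂ c (s, y))
        (fderiv ℂ (fderiv ℂ c) (0, y) (1, 0)) 0 :=
      hdc.hasFDerivAt.comp_hasDerivAt (0 : ℂ)
        ((hasDerivAt_id (0 : ℂ)).prodMk (hasDerivAt_const (0 : ℂ) y))
    have h2 := h1.clm_apply (hasDerivAt_const (0 : ℂ) ((0 : ℂ), w i))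
    have h3 : HasDerivAt (fun s => fderiv ℂ (fun z => c (s, z)) y (w i))
        (fderiv ℂ V y (w i)) 0 := by
      rw [hfV, hsymm.eq (0, w i) (1, 0)]
      simp only [map_zero, add_zero] at h2
      exact h2.congr_of_eventuallyEq (hspace.mono fun s hs => hs (w i))
    exact h3.hasFDerivAt
  have hid : ∀ v, fderiv ℂ (fun z => c (0, z)) y v = v := by
    intro v
    have h1 : (fun z => c (0, z)) =ᶠ[𝓝 y] id := hc0
    rw [h1.fderiv_eq, fderiv_id]
    rfl
  have h := (hβc.continuousAlternatingMap_apply hM).hasDerivAt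
  simp only [hc00, hid] at h
  refine h.congr_deriv ?_
  simp [lieDeriv]

end Volume

/-! ### Flows of divergence free fields preserve the volume form. -/

section VolumeFlow

variable {E : Type*} [NormedAddCommGroup E] [NormedSpace ℂ E]
  {X : Type*} [TopologicalSpace X] [ChartedSpace E X]

theorem contDiffAt_of_contMDiffAt_prod {E F G : Type*} [NormedAddCommGroup E] [NormedSpace ℂ E]
    [NormedAddCommGroup F] [NormedSpace ℂ F] [NormedAddCommGroup G] [NormedSpace ℂ G]
    {c : E × F → G} {p : E × F} (h : ContMDiffAt (𝓘(ℂ, E).prod 𝓘(ℂ, F)) 𝓘(ℂ, G) ω c p) :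
    ContDiffAt ℂ ω c p := by
  rw [← modelWithCornersSelf_prod, chartedSpaceSelf_prod] at h
  exact h.contDiffAt

variable (E) in
/-- The differential of a self-map of `X`, as an endomorphism of the model space. -/
noncomputable def modelDeriv (Φ : X → X) (x : X) : E →L[ℂ] E :=
  mfderiv 𝓘(ℂ, E) 𝓘(ℂ, E) Φ x

variable (E) in
/-- The map `Φ` preserves the form `η`. -/
def PreservesForm (η : TopForm E X) (Φ : X → X) : Prop :=
  ∀ x : X, (η (Φ x)).compContinuousLinearMap (mfderiv 𝓘(ℂ, E) 𝓘(ℂ, E) Φ x) = η x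

theorem topForm_congr (η : TopForm E X) {x y : X} (h : x = y)
    (w : Fin (Module.finrank ℂ E) → E) : η x w = η y w := by
  subst h
  rfl

theorem preservesForm_iff {η : TopForm E X} {Φ : X → X} :
    PreservesForm E η Φ ↔ ∀ (x : X) (w : Fin (Module.finrank ℂ E) → E),
      η (Φ x) (fun i => modelDeriv E Φ x (w i)) = η x w :=
  ⟨fun h x w => congrArg (fun β : E [⋀^Fin (Module.finrank ℂ E)]→L[ℂ] ℂ => β w) (h x),
    fun h x => ContinuousAlternatingMap.ext fun w => h x w⟩

theorem modelDeriv_comp {Φ Ψ : X → X} {x : X} (hΦ : ContMDiff 𝓘(ℂ, E) 𝓘(ℂ, E) ω Φ)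
    (hΨ : ContMDiff 𝓘(ℂ, E) 𝓘(ℂ, E) ω Ψ) (v : E) :
    modelDeriv E (Φ ∘ Ψ) x v = modelDeriv E Φ (Ψ x) (modelDeriv E Ψ x v) := by
  have h := mfderiv_comp x (hΦ.mdifferentiableAt (by simp)) (hΨ.mdifferentiableAt (by simp))
  exact congrArg (fun A : E →L[ℂ] E => A v) h

theorem PreservesForm.comp {η : TopForm E X} {Φ Ψ : X → X}
    (hΦ : ContMDiff 𝓘(ℂ, E) 𝓘(ℂ, E) ω Φ) (hΨ : ContMDiff 𝓘(ℂ, E) 𝓘(ℂ, E) ω Ψ)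
    (h1 : PreservesForm E η Φ) (h2 : PreservesForm E η Ψ) : PreservesForm E η (Φ ∘ Ψ) := by
  rw [preservesForm_iff] at *
  intro x w
  simp only [modelDeriv_comp hΦ hΨ]
  exact (h1 (Ψ x) _).trans (h2 x w)

theorem modelDeriv_id (x : X) (v : E) : modelDeriv E (id : X → X) x v = v := by
  rw [modelDeriv, mfderiv_id]
  rfl

variable [IsManifold 𝓘(ℂ, E) ω X]

/-- Along the flow of `Θ`, the pullback of a form has derivative `L_Θ η` at time zero. -/
theorem hasDerivAt_pullback_flow {η : TopForm E X}
    (hη : IsVolumeForm η) {Θ : VField E X} (hdiv : IsDivFree η Θ) {φ : ℂ → X → X}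
    (hφ : IsHolFlow E φ) (hvel : ∀ x t, HasMFDerivAt 𝓘(ℂ, ℂ) 𝓘(ℂ, E) (fun s => φ s x) t
      ((1 : ℂ →L[ℂ] ℂ).smulRight (Θ (φ t x)))) (y : X) (w : Fin (Module.finrank ℂ E) → E) :
    HasDerivAt (fun s => η (φ s y) fun i => modelDeriv E (φ s) y (w i)) 0 0 := by
  set e := extChartAt 𝓘(ℂ, E) y with he
  have hys : y ∈ e.source := mem_extChartAt_source y
  have hyt : e y ∈ e.target := mem_extChartAt_target y
  have htgt : e.target ∈ 𝓝 (e y) := extChartAt_target_mem_nhds y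
  let c : ℂ × E → E := fun p => e (φ p.1 (e.symm p.2))
  have hc : ContDiffAt ℂ ω c (0, e y) := by
    refine contDiffAt_of_contMDiffAt_prod ?_
    have h1 : ContMDiffAt (𝓘(ℂ, ℂ).prod 𝓘(ℂ, E)) (𝓘(ℂ, ℂ).prod 𝓘(ℂ, E)) ω
        (fun p : ℂ × E => (p.1, e.symm p.2)) (0, e y) :=
      contMDiffAt_fst.prodMk ((contMDiffAt_chart_symm hyt).comp ((0 : ℂ), e y) contMDiffAt_snd)
    have h2 : ContMDiffAt (𝓘(ℂ, ℂ).prod 𝓘(ℂ, E)) 𝓘(ℂ, E) ω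
        (fun p : ℂ × E => φ p.1 (e.symm p.2)) (0, e y) :=
      ContMDiffAt.comp ((0 : ℂ), e y) (g := fun p : ℂ × X => φ p.1 p.2) (hφ.contMDiff _) h1
    refine ContMDiffAt.comp ((0 : ℂ), e y) (g := e) ?_ h2
    refine contMDiffAt_chart ?_
    simp only [hφ.zero, e.left_inv hys]
    exact hys
  have hc0 : ∀ᶠ z in 𝓝 (e y), c (0, z) = z := by
    filter_upwards [htgt] with z hz
    simp only [c, hφ.zero, e.right_inv hz]
  have hcV : ∀ᶠ z in 𝓝 (e y), HasDerivAt (fun s => c (s, z)) (Θ.inChart y z) 0 := by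
    filter_upwards [htgt] with z hz
    have h1 : φ 0 (e.symm z) ∈ e.source := by
      rw [hφ.zero]
      exact e.map_target hz
    have h2 := hasDerivAt_chart_comp (hvel (e.symm z) 0) h1
    rwa [hφ.zero, e.right_inv hz] at h2
  have hβ : DifferentiableAt ℂ (η.inChart y) (e y) :=
    ((hη.1 y).contDiffAt htgt).differentiableAt (by simp)
  let A : E →L[ℂ] E := mfderiv 𝓘(ℂ, E) 𝓘(ℂ, E) e y
  have hA : HasMFDerivAt 𝓘(ℂ, E) 𝓘(ℂ, E) e y A :=
    ((contMDiffAt_chart hys).mdifferentiableAt (by simp)).hasMFDerivAt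
  have hlie := hasDerivAt_pullback_lieDeriv hβ hc hc0 hcV (fun i => A (w i))
  rw [hdiv y (e y) hyt] at hlie
  refine hlie.congr_of_eventuallyEq ?_
  have hsrc : ∀ᶠ s in 𝓝 (0 : ℂ), φ s y ∈ e.source := by
    refine (hφ.contMDiff_time y).continuous.continuousAt.eventually_mem ?_
    rw [hφ.zero]
    exact extChartAt_source_mem_nhds y
  filter_upwards [hsrc] with s hs
  have hcs : c (s, e y) = e (φ s y) := by simp only [c, e.left_inv hys]
  have hst : e (φ s y) ∈ e.target := e.map_source hs
  have hBA : ∀ v : E, (mfderiv 𝓘(ℂ, E) 𝓘(ℂ, E) e.symm (e y) : E →L[ℂ] E) (A v) = v := by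
    intro v
    have h := mfderiv_symm_comp_chart hyt
    rw [← he, e.left_inv hys] at h
    exact congrArg (fun B : E →L[ℂ] E => B v) h
  have hder : ∀ v : E, fderiv ℂ (fun z => c (s, z)) (e y) (A v)
      = (mfderiv 𝓘(ℂ, E) 𝓘(ℂ, E) e (φ s y) : E →L[ℂ] E) (modelDeriv E (φ s) y v) := by
    intro v
    have h1 := ((contMDiffAt_chart_symm hyt).mdifferentiableAt (by simp)).hasMFDerivAt
    have h2 := (((hφ.contMDiff_space s).mdifferentiableAt (by simp)
      (x := e.symm (e y)))).hasMFDerivAt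
    have h3 : MDifferentiableAt 𝓘(ℂ, E) 𝓘(ℂ, E) e (φ s (e.symm (e y))) := by
      rw [e.left_inv hys]
      exact (contMDiffAt_chart hs).mdifferentiableAt (by simp)
    have h4 : HasFDerivAt (fun z => c (s, z))
        ((show E →L[ℂ] E from mfderiv 𝓘(ℂ, E) 𝓘(ℂ, E) e (φ s (e.symm (e y)))).comp
          ((modelDeriv E (φ s) (e.symm (e y))).comp
            (show E →L[ℂ] E from mfderiv 𝓘(ℂ, E) 𝓘(ℂ, E) e.symm (e y)))) (e y) :=
      (h3.hasMFDerivAt.comp (e y) (h2.comp (e y) h1)).hasFDerivAt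
    have h5 := congrArg (fun B : E →L[ℂ] E => B (A v)) h4.fderiv
    have h6 : fderiv ℂ (fun z => c (s, z)) (e y) (A v)
      = (mfderiv 𝓘(ℂ, E) 𝓘(ℂ, E) e (φ s (e.symm (e y))) : E →L[ℂ] E)
          (modelDeriv E (φ s) (e.symm (e y))
            ((mfderiv 𝓘(ℂ, E) 𝓘(ℂ, E) e.symm (e y) : E →L[ℂ] E) (A v))) := h5
    rw [h6, hBA v]
    have h7 : ∀ z : X, z = y → (mfderiv 𝓘(ℂ, E) 𝓘(ℂ, E) e (φ s z) : E →L[ℂ] E)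
          (modelDeriv E (φ s) z v) = (mfderiv 𝓘(ℂ, E) 𝓘(ℂ, E) e (φ s y) : E →L[ℂ] E)
          (modelDeriv E (φ s) y v) := by
      rintro z rfl
      rfl
    exact h7 _ (e.left_inv hys)
  -- The chart differential at φ_s(y) cancels against the inverse chart in `inChart`, so the
  -- pullback computed in the chart is the intrinsic one.
  have hback : ∀ v : E, (mfderiv 𝓘(ℂ, E) 𝓘(ℂ, E) e.symm (e (φ s y)) : E →L[ℂ] E)
      ((mfderiv 𝓘(ℂ, E) 𝓘(ℂ, E) e (φ s y) : E →L[ℂ] E) v) = v := by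
    intro v
    have h := mfderiv_symm_comp_chart hst
    rw [← he, e.left_inv hs] at h
    exact congrArg (fun B : E →L[ℂ] E => B v) h
  simp only [hder, hcs]
  change _ = η (e.symm (e (φ s y))) fun i =>
    (mfderiv 𝓘(ℂ, E) 𝓘(ℂ, E) e.symm (e (φ s y)) : E →L[ℂ] E)
      ((mfderiv 𝓘(ℂ, E) 𝓘(ℂ, E) e (φ s y) : E →L[ℂ] E) (modelDeriv E (φ s) y (w i)))
  simp only [hback]
  exact topForm_congr η (e.left_inv hs).symm _

/-- The flow of a divergence free field preserves the volume form. -/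
theorem preservesForm_flow {η : TopForm E X}
    (hη : IsVolumeForm η) {Θ : VField E X} (hdiv : IsDivFree η Θ) {φ : ℂ → X → X}
    (hφ : IsHolFlow E φ) (hvel : ∀ x t, HasMFDerivAt 𝓘(ℂ, ℂ) 𝓘(ℂ, E) (fun s => φ s x) t
      ((1 : ℂ →L[ℂ] ℂ).smulRight (Θ (φ t x)))) (t : ℂ) : PreservesForm E η (φ t) := by
  rw [preservesForm_iff]
  intro x w
  set g : ℂ → ℂ := fun s => η (φ s x) fun i => modelDeriv E (φ s) x (w i) with hg
  -- Since φ_s = φ_{s - t} ∘ φ_t, the derivative at time `t` is the derivative at time 0 for the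
  -- base point φ_t(x) and the transported vectors.
  have hder : ∀ t, HasDerivAt g 0 t := by
    intro t
    have h1 := hasDerivAt_pullback_flow hη hdiv hφ hvel (φ t x) fun i => modelDeriv E (φ t) x (w i)
    have h2 : HasDerivAt (fun s : ℂ => s - t) 1 t := (hasDerivAt_id t).sub_const t
    have h3 := HasDerivAt.comp_of_eq t h1 h2 (sub_self t).symm
    simp only [zero_mul] at h3
    refine h3.congr_of_eventuallyEq (Eventually.of_forall fun s => ?_)
    have h4 : φ s = φ (s - t) ∘ φ t := by
      ext z
      rw [Function.comp, ← hφ.add, sub_add_cancel]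
    have h5 : φ s x = φ (s - t) (φ t x) := congrFun h4 x
    change η (φ s x) (fun i => modelDeriv E (φ s) x (w i)) = η (φ (s - t) (φ t x)) _
    rw [topForm_congr η h5]
    congr 1
    ext i
    rw [h4]
    exact modelDeriv_comp (hφ.contMDiff_space _) (hφ.contMDiff_space _) _
  have hconst : g t = g 0 :=
    is_const_of_deriv_eq_zero (fun t => (hder t).differentiableAt) (fun t => (hder t).deriv) t 0
  have h0 : φ 0 = id := funext hφ.zero
  have hg0 : g 0 = η x w := by
    simp only [hg, h0, modelDeriv_id]
    exact topForm_congr η (hφ.zero x) w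
  exact hconst.trans hg0

end VolumeFlow

/-! ### Linear algebra of the form du ∧ dv ∧ β. -/

section Algebra

theorem wedge_apply {M : Type*} [AddCommGroup M] [Module ℂ M] {k : ℕ}
    (α : M →ₗ[ℂ] ℂ) (β : M [⋀^Fin k]→ₗ[ℂ] ℂ) (w : Fin (k + 1) → M) :
    wedge α β w = ∑ i : Fin (k + 1), (-1) ^ (i : ℕ) • (α (w i) * β (Fin.removeNth i w)) := by
  rw [wedge, AlternatingMap.alternatizeUncurryFin_apply]
  rfl

/-- In the expansion of the wedge only the term that feeds `v` to `α` survives. -/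
theorem wedge_cons_of_forall_eq_zero {M : Type*} [AddCommGroup M] [Module ℂ M] {k : ℕ}
    (α : M →ₗ[ℂ] ℂ) (β : M [⋀^Fin k]→ₗ[ℂ] ℂ) (v : M) {w : Fin k → M} (hw : ∀ i, α (w i) = 0) :
    wedge α β (Fin.cons v w) = α v * β w := by
  rw [wedge_apply, Fin.sum_univ_succ, Finset.sum_eq_zero]
  · simp
  · intro i _
    simp [hw]

/-- Removing any later entry leaves `v` among the arguments of the pulled back form, and `π` kills
it. -/
theorem wedge_comp_cons_of_eq_zero {M N : Type*} [AddCommGroup M] [Module ℂ M] [AddCommGroup N]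
    [Module ℂ N] {k : ℕ} (α : M →ₗ[ℂ] ℂ) (β : N [⋀^Fin k]→ₗ[ℂ] ℂ) (π : M →ₗ[ℂ] N) {v : M}
    (hv : π v = 0) (w : Fin k → M) :
    wedge α (β.compLinearMap π) (Fin.cons v w) = α v * β fun i => π (w i) := by
  rw [wedge_apply, Fin.sum_univ_succ, Finset.sum_eq_zero]
  · simp
  · intro i _
    obtain _ | k := k
    · exact i.elim0
    · have h : (β.compLinearMap π) (Fin.removeNth i.succ (Fin.cons v w : Fin (k + 2) → M)) = 0 := by
        rw [AlternatingMap.compLinearMap_apply]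
        refine β.map_coord_zero 0 ?_
        simp [Fin.removeNth, hv]
      rw [h]
      simp

variable {E : Type*} [NormedAddCommGroup E] [NormedSpace ℂ E]

/-- The form `du ∧ dv ∧ β` on `ℂ × ℂ × E`. -/
noncomputable def suspendForm {k : ℕ} (β : E [⋀^Fin k]→ₗ[ℂ] ℂ) :
    (ℂ × ℂ × E) [⋀^Fin (k + 2)]→ₗ[ℂ] ℂ :=
  wedge (LinearMap.fst ℂ ℂ (ℂ × E)) (wedge (LinearMap.fst ℂ ℂ E ∘ₗ LinearMap.snd ℂ ℂ (ℂ × E))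
    (β.compLinearMap (LinearMap.snd ℂ ℂ E ∘ₗ LinearMap.snd ℂ ℂ (ℂ × E))))

/-- A tuple of vectors in `ℂ × ℂ × E` with a triangular shape. -/
def triangularTuple {k : ℕ} (a : ℂ × ℂ × E) (d : ℂ) (b : Fin k → ℂ) (ξ : Fin k → E) :
    Fin (k + 2) → ℂ × ℂ × E :=
  Fin.cons a (Fin.cons (0, d, 0) fun i => (0, b i, ξ i))

theorem suspendForm_triangularTuple {k : ℕ} (β : E [⋀^Fin k]→ₗ[ℂ] ℂ) (a : ℂ × ℂ × E) (d : ℂ)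
    (b : Fin k → ℂ) (ξ : Fin k → E) :
    suspendForm β (triangularTuple a d b ξ) = a.1 * (d * β ξ) := by
  rw [suspendForm, triangularTuple, wedge_cons_of_forall_eq_zero, wedge_comp_cons_of_eq_zero]
  · rfl
  · rfl
  · intro i
    refine Fin.cases rfl (fun j => rfl) i

theorem comp_triangularTuple {k : ℕ} (L : ℂ × ℂ × E →ₗ[ℂ] ℂ × ℂ × E) {d d' : ℂ}
    (hL : L (0, d, 0) = (0, d', 0)) (a : ℂ × ℂ × E) (b b' : Fin k → ℂ) (ξ ξ' : Fin k → E)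
    (hξ : ∀ i, L (0, b i, ξ i) = (0, b' i, ξ' i)) :
    (fun i => L (triangularTuple a d b ξ i)) = triangularTuple (L a) d' b' ξ' := by
  funext i
  refine Fin.cases rfl (fun j => ?_) i
  refine Fin.cases hL (fun l => ?_) j
  exact hξ l

theorem exists_basis_eq_triangularTuple [FiniteDimensional ℂ E] :
    ∃ (b : Module.Basis (Fin (Module.finrank ℂ E)) ℂ E)
      (B : Module.Basis (Fin (Module.finrank ℂ E + 2)) ℂ (ℂ × ℂ × E)),
      ∀ i, B i = triangularTuple (1, 0, 0) 1 0 b i := by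
  let b := Module.finBasis ℂ E
  let e₁ : (ℂ × E) ≃ₗ[ℂ] (Fin (Module.finrank ℂ E + 1) → ℂ) :=
    (LinearEquiv.prodCongr (LinearEquiv.refl ℂ ℂ) b.equivFun).trans
      (Fin.consLinearEquiv ℂ fun _ => ℂ)
  let e₂ : (ℂ × ℂ × E) ≃ₗ[ℂ] (Fin (Module.finrank ℂ E + 2) → ℂ) :=
    (LinearEquiv.prodCongr (LinearEquiv.refl ℂ ℂ) e₁).trans (Fin.consLinearEquiv ℂ fun _ => ℂ)
  refine ⟨b, Module.Basis.ofEquivFun e₂, fun i => ?_⟩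
  rw [Module.Basis.coe_ofEquivFun, LinearEquiv.symm_apply_eq]
  have hcons : ∀ p, e₂ p = Fin.cons p.1 (Fin.cons p.2.1 (b.equivFun p.2.2) :
    Fin (Module.finrank ℂ E + 1) → ℂ) := fun p => rfl
  rw [hcons]
  refine Fin.cases ?_ (fun j => ?_) i
  · funext l
    refine Fin.cases ?_ (fun l => ?_) l
    · simp [triangularTuple]
    · refine Fin.cases ?_ (fun l => ?_) l <;> simp [triangularTuple]
  · refine Fin.cases ?_ (fun j => ?_) j
    · funext l
      refine Fin.cases ?_ (fun l => ?_) l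
      · simp [triangularTuple]
      · refine Fin.cases ?_ (fun l => ?_) l
        · simp [triangularTuple]
        · simp [triangularTuple, Fin.ext_iff]
    · funext l
      refine Fin.cases ?_ (fun l => ?_) l
      · simp [triangularTuple]
      · refine Fin.cases ?_ (fun l => ?_) l
        · simp [triangularTuple, Fin.ext_iff]
        · simp [triangularTuple, Finsupp.single_apply, Pi.single_apply, eq_comm]

/-- Forms of top degree on `ℂ × ℂ × E` are determined by their value on one basis. -/
theorem exists_basis_forall_eq [FiniteDimensional ℂ E] :
    ∃ b : Module.Basis (Fin (Module.finrank ℂ E)) ℂ E,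
      ∀ S T : (ℂ × ℂ × E) [⋀^Fin (Module.finrank ℂ E + 2)]→ₗ[ℂ] ℂ,
        S (triangularTuple (1, 0, 0) 1 0 b) = T (triangularTuple (1, 0, 0) 1 0 b) → S = T := by
  obtain ⟨b, B, hB⟩ := exists_basis_eq_triangularTuple (E := E)
  refine ⟨b, fun S T h => ?_⟩
  have hBfun : (B : Fin (Module.finrank ℂ E + 2) → ℂ × ℂ × E) = triangularTuple (1, 0, 0) 1 0 b :=
    funext hB
  rw [S.eq_smul_basis_det B, T.eq_smul_basis_det B, hBfun, h]

/-- Pullback of `du ∧ dv ∧ β'` under a triangular endomorphism. -/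
theorem suspendForm_comp_of_triangular [FiniteDimensional ℂ E]
    {β β' : E [⋀^Fin (Module.finrank ℂ E)]→ₗ[ℂ] ℂ} (L : ℂ × ℂ × E →ₗ[ℂ] ℂ × ℂ × E) {a d : ℂ}
    (had : a * d = 1) (ha : (L (1, 0, 0)).1 = a) (hd : L (0, 1, 0) = (0, d, 0)) (M : E →ₗ[ℂ] E)
    (hM : ∀ ξ, (L (0, 0, ξ)).1 = 0 ∧ (L (0, 0, ξ)).2.2 = M ξ) (hβ : β'.compLinearMap M = β) :
    (suspendForm β').compLinearMap L = suspendForm β := by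
  obtain ⟨b, hb⟩ := exists_basis_forall_eq (E := E)
  refine hb _ _ ?_
  have h := comp_triangularTuple L hd (1, 0, 0) 0 (fun i => (L (0, 0, b i)).2.1) b (fun i => M (b i))
    (fun i => Prod.ext (hM (b i)).1 (Prod.ext rfl (hM (b i)).2))
  change suspendForm β' (fun i => L (triangularTuple (1, 0, 0) 1 0 b i)) = _
  rw [h, suspendForm_triangularTuple, suspendForm_triangularTuple, ha, ← mul_assoc, had, ← hβ]
  simp

/-- The exchange of the first two coordinates changes the sign of `du ∧ dv ∧ β`. -/
theorem suspendForm_comp_swap [FiniteDimensional ℂ E]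
    {β : E [⋀^Fin (Module.finrank ℂ E)]→ₗ[ℂ] ℂ} (L : ℂ × ℂ × E →ₗ[ℂ] ℂ × ℂ × E)
    (hL : ∀ a b ξ, L (a, b, ξ) = (b, a, ξ)) :
    (suspendForm β).compLinearMap L = -suspendForm β := by
  obtain ⟨b, hb⟩ := exists_basis_forall_eq (E := E)
  refine hb _ _ ?_
  -- On the chosen basis the exchange of coordinates is the transposition of the first two basis
  -- vectors, which accounts for the sign.
  rw [AlternatingMap.neg_apply, ← AlternatingMap.map_swap _ _ (show (0 : Fin _) ≠ 1 by simp)]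
  change suspendForm β (fun i => L (triangularTuple (1, 0, 0) 1 0 b i)) = _
  congr 1
  funext i
  refine Fin.cases ?_ (fun j => ?_) i
  · simp [triangularTuple, hL]
  · refine Fin.cases ?_ (fun l => ?_) j
    · simp [triangularTuple, hL]
    · rw [Function.comp, Equiv.swap_apply_of_ne_of_ne]
      · simp [triangularTuple, hL]
      · exact Fin.succ_ne_zero _
      · intro h
        exact Fin.succ_ne_zero l (Fin.succ_injective _ h)

end Algebra

/-! ### Ambient automorphisms preserving uv - f and their restriction. -/

section Ambient

variable {E : Type*} [NormedAddCommGroup E] [NormedSpace ℂ E]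
  {X : Type*} [TopologicalSpace X] [ChartedSpace E X]

variable (E) in
/-- The differential of a self-map of `ℂ × ℂ × X`, as an endomorphism of the model space. -/
noncomputable def ambDeriv (F : ℂ × ℂ × X → ℂ × ℂ × X) (q : ℂ × ℂ × X) :
    ℂ × ℂ × E →L[ℂ] ℂ × ℂ × E :=
  mfderiv (ambI E) (ambI E) F q

theorem ambDeriv_eq {F : ℂ × ℂ × X → ℂ × ℂ × X} {q : ℂ × ℂ × X}
    {L : ℂ × ℂ × E →L[ℂ] ℂ × ℂ × E} (h : HasMFDerivAt (ambI E) (ambI E) F q L) :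
    ambDeriv E F q = L := h.mfderiv

theorem ambDeriv_comp {F G : ℂ × ℂ × X → ℂ × ℂ × X} (hF : ContMDiff (ambI E) (ambI E) ω F)
    (hG : ContMDiff (ambI E) (ambI E) ω G) (q : ℂ × ℂ × X) (w : ℂ × ℂ × E) :
    ambDeriv E (F ∘ G) q w = ambDeriv E F (G q) (ambDeriv E G q w) := by
  have h := mfderiv_comp q (hF.mdifferentiableAt (by simp)) (hG.mdifferentiableAt (by simp))
  exact congrArg (fun A : ℂ × ℂ × E →L[ℂ] ℂ × ℂ × E => A w) h

theorem ambDeriv_id (q : ℂ × ℂ × X) (w : ℂ × ℂ × E) :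
    ambDeriv E (id : ℂ × ℂ × X → ℂ × ℂ × X) q w = w := by
  rw [ambDeriv, mfderiv_id]
  rfl

theorem hasMFDerivAt_amb_fst (q : ℂ × ℂ × X) :
    HasMFDerivAt (ambI E) 𝓘(ℂ, ℂ) (fun r : ℂ × ℂ × X => r.1) q
      (ContinuousLinearMap.fst ℂ ℂ (ℂ × E)) := hasMFDerivAt_fst q

theorem hasMFDerivAt_amb_snd_fst (q : ℂ × ℂ × X) :
    HasMFDerivAt (ambI E) 𝓘(ℂ, ℂ) (fun r : ℂ × ℂ × X => r.2.1) q
      ((ContinuousLinearMap.fst ℂ ℂ E).comp (ContinuousLinearMap.snd ℂ ℂ (ℂ × E))) := by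
  have h2 : HasMFDerivAt (ambI E) (𝓘(ℂ, ℂ).prod 𝓘(ℂ, E)) (fun r : ℂ × ℂ × X => r.2) q
      (ContinuousLinearMap.snd ℂ ℂ (ℂ × E)) := hasMFDerivAt_snd q
  have h3 : HasMFDerivAt (𝓘(ℂ, ℂ).prod 𝓘(ℂ, E)) 𝓘(ℂ, ℂ) (fun r : ℂ × X => r.1) q.2
      (ContinuousLinearMap.fst ℂ ℂ E) := hasMFDerivAt_fst q.2
  exact h3.comp q h2

theorem hasMFDerivAt_amb_snd_snd (q : ℂ × ℂ × X) :
    HasMFDerivAt (ambI E) 𝓘(ℂ, E) (fun r : ℂ × ℂ × X => r.2.2) q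
      ((ContinuousLinearMap.snd ℂ ℂ E).comp (ContinuousLinearMap.snd ℂ ℂ (ℂ × E))) := by
  have h2 : HasMFDerivAt (ambI E) (𝓘(ℂ, ℂ).prod 𝓘(ℂ, E)) (fun r : ℂ × ℂ × X => r.2) q
      (ContinuousLinearMap.snd ℂ ℂ (ℂ × E)) := hasMFDerivAt_snd q
  have h4 : HasMFDerivAt (𝓘(ℂ, ℂ).prod 𝓘(ℂ, E)) 𝓘(ℂ, E) (fun r : ℂ × X => r.2) q.2
      (ContinuousLinearMap.snd ℂ ℂ E) := hasMFDerivAt_snd q.2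
  exact h4.comp q h2

theorem hasMFDerivAt_amb_mk {F : ℂ × ℂ × X → ℂ × ℂ × X} {q : ℂ × ℂ × X}
    {L₁ L₂ : ℂ × ℂ × E →L[ℂ] ℂ} {L₃ : ℂ × ℂ × E →L[ℂ] E}
    (h₁ : HasMFDerivAt (ambI E) 𝓘(ℂ, ℂ) (fun r => (F r).1) q L₁)
    (h₂ : HasMFDerivAt (ambI E) 𝓘(ℂ, ℂ) (fun r => (F r).2.1) q L₂)
    (h₃ : HasMFDerivAt (ambI E) 𝓘(ℂ, E) (fun r => (F r).2.2) q L₃) :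
    HasMFDerivAt (ambI E) (ambI E) F q (L₁.prod (L₂.prod L₃)) :=
  h₁.prodMk (h₂.prodMk h₃)

/-- The form `du ∧ dv ∧ η` at `q`, as a form on the model space. -/
noncomputable def ambFormAt (η : TopForm E X) (q : ℂ × ℂ × X) :
    (ℂ × ℂ × E) [⋀^Fin (Module.finrank ℂ E + 2)]→ₗ[ℂ] ℂ := ambForm η q

/-- The form `η` at `x`, as a form on the model space. -/
noncomputable def modelForm (η : TopForm E X) (x : X) :
    E [⋀^Fin (Module.finrank ℂ E)]→ₗ[ℂ] ℂ :=
  (show E [⋀^Fin (Module.finrank ℂ E)]→L[ℂ] ℂ from η x).toAlternatingMap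

theorem ambFormAt_eq (η : TopForm E X) (q : ℂ × ℂ × X) :
    ambFormAt η q = suspendForm (modelForm η q.2.2) := by
  rw [ambFormAt, ambForm, (hasMFDerivAt_amb_fst q).mfderiv, (hasMFDerivAt_amb_snd_fst q).mfderiv,
    (hasMFDerivAt_amb_snd_snd q).mfderiv]
  rfl

/-- The pullback of `du ∧ dv ∧ η` under `F` is its multiple by the constant `c`. -/
def ScalesForm (η : TopForm E X) (c : ℂ) (F : ℂ × ℂ × X → ℂ × ℂ × X) : Prop :=
  ∀ q, (ambFormAt η (F q)).compLinearMap (ambDeriv E F q : ℂ × ℂ × E →ₗ[ℂ] ℂ × ℂ × E)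
    = c • ambFormAt η q

theorem ScalesForm.apply {η : TopForm E X} {c : ℂ} {F : ℂ × ℂ × X → ℂ × ℂ × X}
    (h : ScalesForm η c F) (q : ℂ × ℂ × X) (w : Fin (Module.finrank ℂ E + 2) → ℂ × ℂ × E) :
    ambFormAt η (F q) (fun i => ambDeriv E F q (w i)) = c * ambFormAt η q w :=
  congrArg (fun T : (ℂ × ℂ × E) [⋀^Fin (Module.finrank ℂ E + 2)]→ₗ[ℂ] ℂ => T w) (h q)

theorem ScalesForm.comp {η : TopForm E X} {c d : ℂ} {F G : ℂ × ℂ × X → ℂ × ℂ × X}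
    (hF : ContMDiff (ambI E) (ambI E) ω F) (hG : ContMDiff (ambI E) (ambI E) ω G)
    (h1 : ScalesForm η c F) (h2 : ScalesForm η d G) : ScalesForm η (c * d) (F ∘ G) := by
  intro q
  ext w
  change ambFormAt η (F (G q)) (fun i => ambDeriv E (F ∘ G) q (w i)) = c * d * ambFormAt η q w
  simp only [ambDeriv_comp hF hG]
  rw [h1.apply, h2.apply, mul_assoc]

/-- Invariance under `F` at the point `G q`, applied to vectors pushed forward by `G`, is invariance
under `G`. -/
theorem ScalesForm.of_rightInverse {η : TopForm E X} {F G : ℂ × ℂ × X → ℂ × ℂ × X}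
    (hF : ContMDiff (ambI E) (ambI E) ω F) (hG : ContMDiff (ambI E) (ambI E) ω G)
    (h : ScalesForm η 1 F) (hFG : F ∘ G = id) : ScalesForm η 1 G := by
  intro q
  ext w
  have h1 := h.apply (G q) fun i => ambDeriv E G q (w i)
  simp only [← ambDeriv_comp hF hG, hFG, ambDeriv_id] at h1
  rw [show F (G q) = q from congrFun hFG q] at h1
  change ambFormAt η (G q) (fun i => ambDeriv E G q (w i)) = 1 * ambFormAt η q w
  rw [one_mul] at h1 ⊢
  exact h1.symm

variable (E) in
/-- The holomorphic automorphisms of `ℂ × ℂ × X` that preserve the function `uv - f`. -/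
def ambAut (f : X → ℂ) : Subgroup (Equiv.Perm (ℂ × ℂ × X)) where
  carrier := {F | ContMDiff (ambI E) (ambI E) ω F ∧ ContMDiff (ambI E) (ambI E) ω F.symm ∧
    ∀ q, defFun f (F q) = defFun f q}
  mul_mem' := by
    rintro F G ⟨hF1, hF2, hF3⟩ ⟨hG1, hG2, hG3⟩
    exact ⟨hF1.comp hG1, hG2.comp hF2, fun q => (hF3 _).trans (hG3 q)⟩
  one_mem' := ⟨contMDiff_id, contMDiff_id, fun _ => rfl⟩
  inv_mem' := by
    rintro F ⟨hF1, hF2, hF3⟩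
    refine ⟨hF2, hF1, fun q => ?_⟩
    have h := hF3 (F.symm q)
    rw [F.apply_symm_apply] at h
    exact h.symm

/-- The holomorphic automorphisms of `ℂ × ℂ × X` that preserve the function `uv - f` and the form
`du ∧ dv ∧ η`. -/
def ambVolumeAut (f : X → ℂ) (η : TopForm E X) : Subgroup (Equiv.Perm (ℂ × ℂ × X)) where
  carrier := {F | F ∈ ambAut E f ∧ ScalesForm η 1 F}
  mul_mem' := by
    rintro F G ⟨hF1, hF2⟩ ⟨hG1, hG2⟩
    refine ⟨mul_mem hF1 hG1, ?_⟩
    simpa using hF2.comp hF1.1 hG1.1 hG2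
  one_mem' := by
    refine ⟨one_mem _, fun q => ?_⟩
    ext w
    change ambFormAt η q (fun i => ambDeriv E (id : ℂ × ℂ × X → ℂ × ℂ × X) q (w i)) =
      1 * ambFormAt η q w
    simp only [ambDeriv_id, one_mul]
  inv_mem' := by
    rintro F ⟨hF1, hF2⟩
    exact ⟨inv_mem hF1, hF2.of_rightInverse hF1.1 hF1.2.1 (funext F.apply_symm_apply)⟩

theorem contMDiff_defFun {f : X → ℂ} (hf : IsHolFun E f) :
    ContMDiff (ambI E) 𝓘(ℂ, ℂ) ω (defFun f) := by
  have h1 : ContMDiff (ambI E) 𝓘(ℂ, ℂ) ω fun r : ℂ × ℂ × X => r.1 := contMDiff_fst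
  have h2 : ContMDiff (ambI E) 𝓘(ℂ, ℂ) ω fun r : ℂ × ℂ × X => r.2.1 :=
    contMDiff_fst.comp contMDiff_snd
  have h3 : ContMDiff (ambI E) 𝓘(ℂ, ℂ) ω fun r : ℂ × ℂ × X => f r.2.2 :=
    ContMDiff.comp (g := f) hf (contMDiff_snd.comp contMDiff_snd)
  exact ContMDiff.sub (ContMDiff.mul h1 h2) h3

/-- This is the derivative of (uv - f) ∘ F = uv - f. Because `F` preserves the function and not only
its zero set, the differentials agree without a factor. -/
theorem dDef_ambDeriv {f : X → ℂ} (hf : IsHolFun E f) {F : Equiv.Perm (ℂ × ℂ × X)}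
    (hF : F ∈ ambAut E f) (q : ℂ × ℂ × X) (w : ℂ × ℂ × E) :
    dDef E f (F q) (ambDeriv E F q w) = dDef E f q w := by
  have h := mfderiv_comp q ((contMDiff_defFun hf).mdifferentiableAt (by simp))
    (hF.1.mdifferentiableAt (by simp))
  have h2 : defFun f ∘ F = defFun f := funext hF.2.2
  have h3 := congrArg (fun A : ℂ × ℂ × E →L[ℂ] ℂ => A w) h
  rw [h2] at h3
  exact h3.symm

/-- The restriction to the suspension of an automorphism of `ℂ × ℂ × X` that preserves `uv - f`. -/
def restrictSusp {f : X → ℂ} (F : ambAut E f) : Susp f ≃ Susp f :=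
  F.1.subtypeEquiv fun q => by rw [F.2.2.2 q]

/-- The differential of the restriction to the suspension. -/
noncomputable def restrictDeriv {f : X → ℂ} (hf : IsHolFun E f) (F : ambAut E f) (p : Susp f) :
    tangent E f p →ₗ[ℂ] tangent E f (restrictSusp F p) where
  toFun w := ⟨ambDeriv E F.1 p.1 (w : TangentSpace (ambI E) p.1), by
    have h : dDef E f p.1 (w : TangentSpace (ambI E) p.1) = 0 := w.2
    exact (dDef_ambDeriv hf F.2 p.1 w.1).trans h⟩
  map_add' v w := Subtype.ext (map_add (ambDeriv E F.1 p.1) v.1 w.1)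
  map_smul' c w := Subtype.ext (map_smul (ambDeriv E F.1 p.1) c w.1)

theorem hasHolDerivAt_restrictSusp {f : X → ℂ} (hf : IsHolFun E f) (F : ambAut E f) (p : Susp f) :
    HasHolDerivAt E f (restrictSusp F) p (restrictDeriv hf F p) :=
  ⟨univ, F.1, isOpen_univ, mem_univ _, F.2.1.contMDiffOn, fun _ _ => rfl, fun _ => rfl⟩

theorem restrictSusp_mem_aut {f : X → ℂ} (hf : IsHolFun E f) (F : ambAut E f) :
    restrictSusp F ∈ aut E f :=
  ⟨fun p => ⟨_, hasHolDerivAt_restrictSusp hf F p⟩,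
    fun p => ⟨_, hasHolDerivAt_restrictSusp hf F⁻¹ p⟩⟩

/-- The form on the suspension is the contraction of du ∧ dv ∧ η with any ν such that d(uv - f)(ν) =
1. The differential of `F` carries such a ν to another one and preserves du ∧ dv ∧ η, hence it
preserves the contraction. -/
theorem restrictSusp_mem_suspVolumeAut [FiniteDimensional ℂ E] {f : X → ℂ} (hf : IsHolFun E f)
    (hred : ∀ x : X, f x = 0 → mfderiv 𝓘(ℂ, E) 𝓘(ℂ, ℂ) f x ≠ 0) {η : TopForm E X}
    {F : Equiv.Perm (ℂ × ℂ × X)} (hF : F ∈ ambVolumeAut f η) :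
    restrictSusp (⟨F, hF.1⟩ : ambAut E f) ∈ suspVolumeAut f η := by
  refine ⟨restrictSusp_mem_aut hf _, fun p => ⟨_, hasHolDerivAt_restrictSusp hf _ p, ?_⟩⟩
  ext w
  obtain ⟨ν, hν⟩ := dDef_surj f hf hred p
  have h1 := dDef_mul_suspForm f hf hred η p ν w
  have h2 := dDef_mul_suspForm f hf hred η (restrictSusp (⟨F, hF.1⟩ : ambAut E f) p)
    (ambDeriv E F p.1 ν) fun i => restrictDeriv hf ⟨F, hF.1⟩ p (w i)
  have h3 : dDef E f (restrictSusp (⟨F, hF.1⟩ : ambAut E f) p).1 (ambDeriv E F p.1 ν) = 1 :=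
    (dDef_ambDeriv hf hF.1 p.1 ν).trans hν
  rw [hν, one_mul] at h1
  rw [h3, one_mul] at h2
  refine h2.trans (Eq.trans ?_ h1.symm)
  have h4 := hF.2.apply p.1 (Matrix.vecCons ν fun i => (w i).1)
  rw [one_mul] at h4
  refine Eq.trans ?_ h4
  change ambFormAt η (F p.1) _ = _
  congr 1
  funext i
  refine Fin.cases rfl (fun j => rfl) i

end Ambient

/-! ### Lifting flows from X to shears. -/

section Shear

variable {E : Type*} [NormedAddCommGroup E] [NormedSpace ℂ E]
  {X : Type*} [TopologicalSpace X] [ChartedSpace E X]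

/-- The divided difference of `f` along the orbits of the flow `φ`. -/
noncomputable def flowSlope (f : X → ℂ) (φ : ℂ → X → X) (p : ℂ × X) : ℂ :=
  dslope (fun s => f (φ s p.2)) 0 p.1

theorem mul_flowSlope {f : X → ℂ} {φ : ℂ → X → X} (hφ : IsHolFlow E φ) (s : ℂ) (x : X) :
    s * flowSlope f φ (s, x) = f (φ s x) - f x := by
  have h := sub_smul_dslope (fun s => f (φ s x)) 0 s
  simpa [hφ.zero, flowSlope] using h

theorem flowSlope_of_ne {f : X → ℂ} {φ : ℂ → X → X} (hφ : IsHolFlow E φ) {s : ℂ} (hs : s ≠ 0)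
    (x : X) : flowSlope f φ (s, x) = (f (φ s x) - f x) / s := by
  rw [← mul_flowSlope hφ, mul_div_cancel_left₀ _ hs]

/-- Away from s = 0 this is a quotient of holomorphic functions. At s = 0 Hadamard's formula is
applied in a chart of X. -/
theorem contMDiff_flowSlope [IsManifold 𝓘(ℂ, E) ω X] {f : X → ℂ} (hf : IsHolFun E f)
    {φ : ℂ → X → X} (hφ : IsHolFlow E φ) :
    ContMDiff (𝓘(ℂ, ℂ).prod 𝓘(ℂ, E)) 𝓘(ℂ, ℂ) ω (flowSlope f φ) := by
  have hfφ : ContMDiff (𝓘(ℂ, ℂ).prod 𝓘(ℂ, E)) 𝓘(ℂ, ℂ) ω fun p : ℂ × X => f (φ p.1 p.2) :=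
    ContMDiff.comp (g := f) hf hφ.contMDiff
  rintro ⟨s, x⟩
  rcases eq_or_ne s 0 with rfl | hs
  · set e := extChartAt 𝓘(ℂ, E) x with he
    have hxs : x ∈ e.source := mem_extChartAt_source x
    have hxt : e x ∈ e.target := mem_extChartAt_target x
    have h1 : ContMDiffAt (𝓘(ℂ, ℂ).prod 𝓘(ℂ, E)) (𝓘(ℂ, ℂ).prod 𝓘(ℂ, E)) ω
        (fun p : ℂ × E => (p.1, e.symm p.2)) (0, e x) :=
      contMDiffAt_fst.prodMk ((contMDiffAt_chart_symm hxt).comp ((0 : ℂ), e x) contMDiffAt_snd)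
    have h2 : ContDiffAt ℂ ω (fun p : ℂ × E => f (φ p.1 (e.symm p.2))) (0, e x) :=
      contDiffAt_of_contMDiffAt_prod (ContMDiffAt.comp ((0 : ℂ), e x)
        (g := fun p : ℂ × X => f (φ p.1 p.2)) (hfφ _) h1)
    have h3 := contMDiffAt_prod_of_contDiffAt (contDiffAt_dslope h2)
    have h4 : ContMDiffAt (𝓘(ℂ, ℂ).prod 𝓘(ℂ, E)) (𝓘(ℂ, ℂ).prod 𝓘(ℂ, E)) ω
        (fun p : ℂ × X => (p.1, e p.2)) (0, x) :=
      contMDiffAt_fst.prodMk ((contMDiffAt_chart hxs).comp ((0 : ℂ), x) contMDiffAt_snd)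
    refine (ContMDiffAt.comp ((0 : ℂ), x) (f := fun p : ℂ × X => (p.1, e p.2))
      h3 h4).congr_of_eventuallyEq ?_
    have hsrc : ∀ᶠ p : ℂ × X in 𝓝 (0, x), p.2 ∈ e.source :=
      continuousAt_snd.eventually_mem (extChartAt_source_mem_nhds (I := 𝓘(ℂ, E)) x)
    filter_upwards [hsrc] with p hp
    simp only [flowSlope, Function.comp, e.left_inv hp]
  · have h1 : ContMDiffAt (𝓘(ℂ, ℂ).prod 𝓘(ℂ, E)) 𝓘(ℂ, ℂ) ω (fun p : ℂ × X => p.1⁻¹) (s, x) :=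
      ContMDiffAt.comp (s, x) (g := fun z : ℂ => z⁻¹) (contDiffAt_inv ℂ hs).contMDiffAt
        contMDiffAt_fst
    have h2 : ContMDiffAt (𝓘(ℂ, ℂ).prod 𝓘(ℂ, E)) 𝓘(ℂ, ℂ) ω
        (fun p : ℂ × X => f (φ p.1 p.2) - f p.2) (s, x) :=
      ContMDiffAt.sub (hfφ (s, x)) (ContMDiffAt.comp (s, x) (g := f) (hf x) contMDiffAt_snd)
    refine (ContMDiffAt.mul h2 h1).congr_of_eventuallyEq ?_
    filter_upwards [continuousAt_fst.eventually_ne (x := (s, x)) hs] with p hp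
    exact flowSlope_of_ne hφ hp p.2

/-- The time-`1` map of the lift of the flow `φ` that fixes the coordinate `u`. -/
noncomputable def shear (f : X → ℂ) (φ : ℂ → X → X) (q : ℂ × ℂ × X) : ℂ × ℂ × X :=
  (q.1, q.2.1 + flowSlope f φ (q.1, q.2.2), φ q.1 q.2.2)

theorem IsHolFlow.scale {φ : ℂ → X → X} (hφ : IsHolFlow E φ) (t : ℂ) :
    IsHolFlow E fun s => φ (t * s) where
  zero x := by rw [mul_zero, hφ.zero]
  add s s' x := by rw [mul_add, hφ.add]
  contMDiff := by
    have h1 : ContMDiff (𝓘(ℂ, ℂ).prod 𝓘(ℂ, E)) 𝓘(ℂ, ℂ) ω fun p : ℂ × X => t * p.1 :=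
      ContMDiff.mul contMDiff_const contMDiff_fst
    exact ContMDiff.comp (g := fun p : ℂ × X => φ p.1 p.2) (f := fun p : ℂ × X => (t * p.1, p.2))
      hφ.contMDiff (h1.prodMk contMDiff_snd)

theorem defFun_shear {f : X → ℂ} {φ : ℂ → X → X} (hφ : IsHolFlow E φ) (q : ℂ × ℂ × X) :
    defFun f (shear f φ q) = defFun f q := by
  change q.1 * (q.2.1 + flowSlope f φ (q.1, q.2.2)) - f (φ q.1 q.2.2) = q.1 * q.2.1 - f q.2.2
  rw [mul_add, mul_flowSlope hφ]
  ring

theorem flowSlope_zero_eq {f : X → ℂ} {φ : ℂ → X → X} (hφ : IsHolFlow E φ)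
    {A : E →L[ℂ] ℂ} {x : X} (hA : HasMFDerivAt 𝓘(ℂ, E) 𝓘(ℂ, ℂ) f x A) :
    flowSlope f φ (0, x) = A (flowVelocity E φ x) := by
  rw [flowSlope, dslope_same]
  exact (hφ.hasDerivAt_comp hA).deriv

/-- The reversed flow keeps `u` and returns to `x`. The increments of `v` cancel: for u ≠ 0 they are
opposite difference quotients, and for u = 0 opposite derivatives. -/
theorem shear_neg_shear {f : X → ℂ} {φ : ℂ → X → X} (hφ : IsHolFlow E φ) (q : ℂ × ℂ × X) :
    shear f (fun s => φ (-s)) (shear f φ q) = q := by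
  have hψ : IsHolFlow E fun s => φ (-s) := by simpa using hφ.scale (-1)
  obtain ⟨u, v, x⟩ := q
  have hx : φ (-u) (φ u x) = x := by rw [← hφ.add, neg_add_cancel, hφ.zero]
  refine Prod.ext rfl (Prod.ext ?_ hx)
  change v + flowSlope f φ (u, x) + flowSlope f (fun s => φ (-s)) (u, φ u x) = v
  rcases eq_or_ne u 0 with rfl | hu
  · rw [hφ.zero]
    have h : flowSlope f (fun s => φ (-s)) (0, x) = -flowSlope f φ (0, x) := by
      simp only [flowSlope, dslope_same]
      have := deriv_comp_neg (fun s => f (φ s x)) (0 : ℂ)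
      simpa using this
    rw [h]
    ring
  · rw [flowSlope_of_ne hφ hu, flowSlope_of_ne hψ hu, hx]
    ring

theorem contMDiff_shear [IsManifold 𝓘(ℂ, E) ω X] {f : X → ℂ} (hf : IsHolFun E f) {φ : ℂ → X → X}
    (hφ : IsHolFlow E φ) : ContMDiff (ambI E) (ambI E) ω (shear f φ) := by
  have h1 : ContMDiff (ambI E) 𝓘(ℂ, ℂ) ω fun r : ℂ × ℂ × X => r.1 := contMDiff_fst
  have h2 : ContMDiff (ambI E) 𝓘(ℂ, ℂ) ω fun r : ℂ × ℂ × X => r.2.1 :=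
    contMDiff_fst.comp contMDiff_snd
  have h3 : ContMDiff (ambI E) 𝓘(ℂ, E) ω fun r : ℂ × ℂ × X => r.2.2 :=
    contMDiff_snd.comp contMDiff_snd
  have h4 : ContMDiff (ambI E) 𝓘(ℂ, ℂ) ω fun r : ℂ × ℂ × X => flowSlope f φ (r.1, r.2.2) :=
    ContMDiff.comp (g := flowSlope f φ) (contMDiff_flowSlope hf hφ) (h1.prodMk h3)
  have h5 : ContMDiff (ambI E) 𝓘(ℂ, E) ω fun r : ℂ × ℂ × X => φ r.1 r.2.2 :=
    ContMDiff.comp (g := fun p : ℂ × X => φ p.1 p.2) hφ.contMDiff (h1.prodMk h3)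
  exact h1.prodMk ((ContMDiff.add h2 h4).prodMk h5)

/-- The lift of a flow as a permutation of `ℂ × ℂ × X`. -/
noncomputable def shearEquiv (f : X → ℂ) {φ : ℂ → X → X} (hφ : IsHolFlow E φ) :
    Equiv.Perm (ℂ × ℂ × X) where
  toFun := shear f φ
  invFun := shear f fun s => φ (-s)
  left_inv := shear_neg_shear hφ
  right_inv q := by
    have hψ : IsHolFlow E fun s => φ (-s) := by simpa using hφ.scale (-1)
    simpa using shear_neg_shear (f := f) hψ q

theorem shearEquiv_mem_ambAut [IsManifold 𝓘(ℂ, E) ω X] {f : X → ℂ} (hf : IsHolFun E f)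
    {φ : ℂ → X → X} (hφ : IsHolFlow E φ) : shearEquiv f hφ ∈ ambAut E f :=
  ⟨contMDiff_shear hf hφ, contMDiff_shear hf (by simpa using hφ.scale (-1)), defFun_shear hφ⟩

/-- The differential is (a, b, ξ) ↦ (a, b + A(a, ξ), B(a, ξ)), where B(0, ·) is the differential of
φ_u at fixed time u. It is triangular with diagonal blocks 1, 1 and dφ_u, so the derivative of the
slope does not affect the volume. -/
theorem scalesForm_shear [FiniteDimensional ℂ E] [IsManifold 𝓘(ℂ, E) ω X] {f : X → ℂ}
    (hf : IsHolFun E f) {φ : ℂ → X → X} (hφ : IsHolFlow E φ) {η : TopForm E X}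
    (hη : ∀ t, PreservesForm E η (φ t)) : ScalesForm η 1 (shear f φ) := by
  intro q
  let P : ℂ × ℂ × E →L[ℂ] ℂ × E := (ContinuousLinearMap.fst ℂ ℂ (ℂ × E)).prod
    ((ContinuousLinearMap.snd ℂ ℂ E).comp (ContinuousLinearMap.snd ℂ ℂ (ℂ × E)))
  have hP : HasMFDerivAt (ambI E) (𝓘(ℂ, ℂ).prod 𝓘(ℂ, E)) (fun r : ℂ × ℂ × X => (r.1, r.2.2)) q P :=
    (hasMFDerivAt_amb_fst q).prodMk (hasMFDerivAt_amb_snd_snd q)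
  let A : ℂ × E →L[ℂ] ℂ := mfderiv (𝓘(ℂ, ℂ).prod 𝓘(ℂ, E)) 𝓘(ℂ, ℂ) (flowSlope f φ) (q.1, q.2.2)
  have hA : HasMFDerivAt (𝓘(ℂ, ℂ).prod 𝓘(ℂ, E)) 𝓘(ℂ, ℂ) (flowSlope f φ) (q.1, q.2.2) A :=
    ((contMDiff_flowSlope hf hφ).mdifferentiableAt (by simp)).hasMFDerivAt
  let B : ℂ × E →L[ℂ] E :=
    mfderiv (𝓘(ℂ, ℂ).prod 𝓘(ℂ, E)) 𝓘(ℂ, E) (fun p : ℂ × X => φ p.1 p.2) (q.1, q.2.2)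
  have hB : HasMFDerivAt (𝓘(ℂ, ℂ).prod 𝓘(ℂ, E)) 𝓘(ℂ, E) (fun p : ℂ × X => φ p.1 p.2)
      (q.1, q.2.2) B := (hφ.contMDiff.mdifferentiableAt (by simp)).hasMFDerivAt
  have hBM : ∀ ξ : E, B (0, ξ) = modelDeriv E (φ q.1) q.2.2 ξ := by
    intro ξ
    have h1 : HasMFDerivAt 𝓘(ℂ, E) (𝓘(ℂ, ℂ).prod 𝓘(ℂ, E)) (fun x : X => (q.1, x)) q.2.2
        (ContinuousLinearMap.inr ℂ ℂ E) := (hasMFDerivAt_const q.1 q.2.2).prodMk (hasMFDerivAt_id _)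
    have h2 : modelDeriv E (φ q.1) q.2.2 = B.comp (ContinuousLinearMap.inr ℂ ℂ E) :=
      (HasMFDerivAt.comp q.2.2 hB h1).mfderiv
    rw [h2]
    rfl
  have hAP : HasMFDerivAt (ambI E) 𝓘(ℂ, ℂ) (fun r : ℂ × ℂ × X => flowSlope f φ (r.1, r.2.2)) q
      (A.comp P) := HasMFDerivAt.comp q hA hP
  have hBP : HasMFDerivAt (ambI E) 𝓘(ℂ, E) (fun r : ℂ × ℂ × X => φ r.1 r.2.2) q
      (B.comp P) := HasMFDerivAt.comp q hB hP
  have hL := ambDeriv_eq (hasMFDerivAt_amb_mk (F := shear f φ) (hasMFDerivAt_amb_fst q)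
    ((hasMFDerivAt_amb_snd_fst q).add hAP) hBP)
  have hLapply : ∀ (a b : ℂ) (ξ : E),
      ambDeriv E (shear f φ) q (a, b, ξ) = (a, b + A (a, ξ), B (a, ξ)) := by
    intro a b ξ
    rw [hL]
    rfl
  rw [one_smul, ambFormAt_eq, ambFormAt_eq]
  refine suspendForm_comp_of_triangular _ (mul_one 1) ?_ ?_
    (modelDeriv E (φ q.1) q.2.2 : E →ₗ[ℂ] E) ?_ ?_
  · exact congrArg Prod.fst (hLapply 1 0 0)
  · refine (hLapply 0 1 0).trans ?_
    have h0 : ((0 : ℂ), (0 : E)) = 0 := rfl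
    rw [h0, map_zero, map_zero, add_zero]
  · intro ξ
    refine ⟨congrArg Prod.fst (hLapply 0 0 ξ), ?_⟩
    exact (congrArg (fun w : ℂ × ℂ × E => w.2.2) (hLapply 0 0 ξ)).trans (hBM ξ)
  · ext w
    exact preservesForm_iff.1 (hη q.1) q.2.2 w

end Shear

/-! ### Hyperbolic maps and the exchange of u and v. -/

section Torus

variable {E : Type*} [NormedAddCommGroup E] [NormedSpace ℂ E]
  {X : Type*} [TopologicalSpace X] [ChartedSpace E X]

/-- The map `(u, v, x) ↦ (lu, l⁻¹v, x)`. -/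
noncomputable def hyperbolic {l : ℂ} (hl : l ≠ 0) : Equiv.Perm (ℂ × ℂ × X) where
  toFun q := (l * q.1, l⁻¹ * q.2.1, q.2.2)
  invFun q := (l⁻¹ * q.1, l * q.2.1, q.2.2)
  left_inv q := by simp [hl]
  right_inv q := by simp [hl]

theorem contMDiff_diagonal (a b : ℂ) :
    ContMDiff (ambI E) (ambI E) ω fun q : ℂ × ℂ × X => (a * q.1, b * q.2.1, q.2.2) := by
  have h1 : ContMDiff (ambI E) 𝓘(ℂ, ℂ) ω fun r : ℂ × ℂ × X => a * r.1 :=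
    ContMDiff.mul contMDiff_const contMDiff_fst
  have h2 : ContMDiff (ambI E) 𝓘(ℂ, ℂ) ω fun r : ℂ × ℂ × X => b * r.2.1 :=
    ContMDiff.mul contMDiff_const (contMDiff_fst.comp contMDiff_snd)
  have h3 : ContMDiff (ambI E) 𝓘(ℂ, E) ω fun r : ℂ × ℂ × X => r.2.2 :=
    contMDiff_snd.comp contMDiff_snd
  exact h1.prodMk (h2.prodMk h3)

theorem hyperbolic_mem_ambAut (f : X → ℂ) {l : ℂ} (hl : l ≠ 0) :
    hyperbolic hl ∈ ambAut E f := by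
  refine ⟨contMDiff_diagonal _ _, contMDiff_diagonal _ _, fun q => ?_⟩
  change l * q.1 * (l⁻¹ * q.2.1) - f q.2.2 = q.1 * q.2.1 - f q.2.2
  field_simp

theorem hyperbolic_mem_ambVolumeAut [FiniteDimensional ℂ E] (f : X → ℂ) (η : TopForm E X) {l : ℂ}
    (hl : l ≠ 0) : hyperbolic hl ∈ ambVolumeAut f η := by
  refine ⟨hyperbolic_mem_ambAut f hl, fun q => ?_⟩
  have hL := ambDeriv_eq (hasMFDerivAt_amb_mk (F := hyperbolic (X := X) hl)
    ((hasMFDerivAt_amb_fst (E := E) q).const_smul l)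
    ((hasMFDerivAt_amb_snd_fst q).const_smul l⁻¹) (hasMFDerivAt_amb_snd_snd q))
  have hLapply : ∀ (a b : ℂ) (ξ : E),
      ambDeriv E (hyperbolic (X := X) hl) q (a, b, ξ) = (l * a, l⁻¹ * b, ξ) := by
    intro a b ξ
    rw [hL]
    rfl
  rw [one_smul, ambFormAt_eq, ambFormAt_eq]
  refine suspendForm_comp_of_triangular _ (mul_inv_cancel₀ hl) ?_ ?_ LinearMap.id ?_ ?_
  · exact (congrArg Prod.fst (hLapply 1 0 0)).trans (mul_one l)
  · refine (hLapply 0 1 0).trans ?_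
    rw [mul_zero, mul_one]
  · intro ξ
    refine ⟨(congrArg Prod.fst (hLapply 0 0 ξ)).trans (mul_zero l), ?_⟩
    exact congrArg (fun w : ℂ × ℂ × E => w.2.2) (hLapply 0 0 ξ)
  · rfl

/-- The exchange of the coordinates `u` and `v`. -/
def exchange : Equiv.Perm (ℂ × ℂ × X) where
  toFun q := (q.2.1, q.1, q.2.2)
  invFun q := (q.2.1, q.1, q.2.2)
  left_inv _ := rfl
  right_inv _ := rfl

theorem exchange_mem_ambAut (f : X → ℂ) : exchange ∈ ambAut E f := by
  have h : ContMDiff (ambI E) (ambI E) ω fun q : ℂ × ℂ × X => (q.2.1, q.1, q.2.2) :=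
    (contMDiff_fst.comp contMDiff_snd).prodMk
      (contMDiff_fst.prodMk (contMDiff_snd.comp contMDiff_snd))
  refine ⟨h, h, fun q => ?_⟩
  change q.2.1 * q.1 - f q.2.2 = q.1 * q.2.1 - f q.2.2
  ring

theorem scalesForm_exchange [FiniteDimensional ℂ E] (η : TopForm E X) :
    ScalesForm η (-1) exchange := by
  intro q
  have hL := ambDeriv_eq (hasMFDerivAt_amb_mk (F := exchange (X := X))
    (hasMFDerivAt_amb_snd_fst (E := E) q) (hasMFDerivAt_amb_fst q) (hasMFDerivAt_amb_snd_snd q))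
  rw [ambFormAt_eq, ambFormAt_eq, neg_one_smul]
  refine suspendForm_comp_swap _ fun a b ξ => ?_
  rw [hL]
  rfl

/-- The exchange multiplies du ∧ dv ∧ η by -1, so it does not belong to the volume group in general;
in a conjugate the two signs cancel. -/
theorem exchange_conj_mem_ambVolumeAut [FiniteDimensional ℂ E] {f : X → ℂ} {η : TopForm E X}
    {F : Equiv.Perm (ℂ × ℂ × X)} (hF : F ∈ ambVolumeAut f η) :
    exchange * F * exchange ∈ ambVolumeAut f η := by
  have hS := exchange_mem_ambAut (E := E) f
  refine ⟨mul_mem (mul_mem hS hF.1) hS, ?_⟩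
  have h := ((scalesForm_exchange η).comp hS.1 hF.1.1 hF.2).comp (hS.1.comp hF.1.1) hS.1
    (scalesForm_exchange η)
  norm_num at h
  exact h

end Torus

/-! ### Orbits on the suspension and proof of the theorem. -/

section Conclusion

variable {E : Type*} [NormedAddCommGroup E] [NormedSpace ℂ E]
  {X : Type*} [TopologicalSpace X] [ChartedSpace E X]

/-- A group of permutations of `ℂ × ℂ × X` which contains the lifts of sufficiently many flows acts
transitively on the suspension. -/
theorem exists_mem_map_eq [IsManifold 𝓘(ℂ, E) ω X] [FiniteDimensional ℂ E] [ConnectedSpace X]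
    {f : X → ℂ} (hf : IsHolFun E f) (hconst : ∃ x y : X, f x ≠ f y)
    (hred : ∀ x : X, f x = 0 → mfderiv 𝓘(ℂ, E) 𝓘(ℂ, ℂ) f x ≠ 0)
    {𝓕 : Set (ℂ → X → X)} (h𝓕 : ∀ φ ∈ 𝓕, IsHolFlow E φ)
    (hspan : ∀ x, Submodule.span ℂ {ξ : E | ∃ φ ∈ 𝓕, flowVelocity E φ x = ξ} = ⊤)
    (G : Subgroup (Equiv.Perm (ℂ × ℂ × X)))
    (hshear : ∀ φ ∈ 𝓕, ∀ t : ℂ, ∃ g ∈ G, ∀ q, g q = shear f (fun s => φ (t * s)) q)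
    (hhyp : ∀ (l : ℂ) (hl : l ≠ 0), hyperbolic hl ∈ G)
    (hexch : ∀ g ∈ G, exchange * g * exchange ∈ G) (p q : Susp f) :
    ∃ g ∈ G, g p.1 = q.1 := by
  let R : ℂ × ℂ × X → ℂ × ℂ × X → Prop := fun p q => ∃ g ∈ G, g p = q
  have hR : Equivalence R :=
    { refl := fun p => ⟨1, one_mem G, rfl⟩
      symm := by
        rintro p q ⟨g, hg, rfl⟩
        exact ⟨g⁻¹, inv_mem hg, g.symm_apply_apply p⟩
      trans := by
        rintro p q r ⟨g, hg, rfl⟩ ⟨g', hg', rfl⟩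
        exact ⟨g' * g, mul_mem hg' hg, rfl⟩ }
  have hfibre : ∀ u : ℂ, u ≠ 0 → ∀ x y : X, R (u, f x / u, x) (u, f y / u, y) := by
    intro u hu
    refine rel_of_span_flowVelocity (R := fun x y => R (u, f x / u, x) (u, f y / u, y)) h𝓕
      ⟨fun x => hR.refl _, fun h => hR.symm h, fun h h' => hR.trans h h'⟩ ?_ hspan
    intro φ hφ t x
    -- At height `u` the shear runs the flow for its time parameter multiplied by `u`, so the
    -- parameter t / u moves `x` exactly to φ_t(x).
    obtain ⟨g, hg, hgs⟩ := hshear φ hφ (t / u)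
    refine ⟨g, hg, ?_⟩
    rw [hgs, shear, flowSlope_of_ne ((h𝓕 φ hφ).scale (t / u)) hu]
    simp only [div_mul_cancel₀ t hu]
    refine Prod.ext rfl (Prod.ext ?_ rfl)
    simp only []
    ring
  obtain ⟨x₁, hx₁⟩ : ∃ x, f x ≠ 0 := by
    obtain ⟨x, y, hxy⟩ := hconst
    by_contra! h
    exact hxy ((h x).trans (h y).symm)
  -- Within its slice the point is moved over `x₁`, then the hyperbolic map with factor u⁻¹
  -- normalizes the first coordinate to 1.
  have hu : ∀ u v x, defFun f (u, v, x) = 0 → u ≠ 0 → R (u, v, x) (1, f x₁, x₁) := by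
    intro u v x hp hu
    have hv : v = f x / u := by
      rw [eq_div_iff hu, mul_comm]
      exact sub_eq_zero.1 hp
    rw [hv]
    refine hR.trans (hfibre u hu x x₁) ⟨_, hhyp u⁻¹ (inv_ne_zero hu), ?_⟩
    refine Prod.ext (inv_mul_cancel₀ hu) (Prod.ext ?_ rfl)
    change u⁻¹⁻¹ * (f x₁ / u) = f x₁
    rw [inv_inv, mul_div_cancel₀ _ hu]
  have hv : ∀ u v x, defFun f (u, v, x) = 0 → v ≠ 0 → R (u, v, x) (1, f x₁, x₁) := by
    intro u v x hp hv
    have hp' : defFun f (v, u, x) = 0 := by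
      change v * u - f x = 0
      rw [mul_comm]
      exact hp
    obtain ⟨g, hg, hgp⟩ := hu v u x hp' hv
    -- Conjugation by the exchange turns the previous case into one for v ≠ 0. The point reached has
    -- first coordinate f(x₁) ≠ 0, which is why `x₁` was chosen off the zero fibre, so the previous
    -- case finishes.
    have h1 : R (u, v, x) (f x₁, 1, x₁) := by
      refine ⟨_, hexch g hg, ?_⟩
      change exchange (g (v, u, x)) = _
      rw [hgp]
      rfl
    refine hR.trans h1 (hu _ _ _ ?_ hx₁)
    change f x₁ * 1 - f x₁ = 0
    ring
  have hall : ∀ p : ℂ × ℂ × X, defFun f p = 0 → R p (1, f x₁, x₁) := by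
    rintro ⟨u, v, x⟩ hp
    rcases ne_or_eq u 0 with hu0 | rfl
    · exact hu u v x hp hu0
    rcases ne_or_eq v 0 with hv0 | rfl
    · exact hv 0 v x hp hv0
    have hfx : f x = 0 := by
      have h : (0 : ℂ) * 0 - f x = 0 := hp
      simpa using h
    let A : E →L[ℂ] ℂ := mfderiv 𝓘(ℂ, E) 𝓘(ℂ, ℂ) f x
    have hA : HasMFDerivAt 𝓘(ℂ, E) 𝓘(ℂ, ℂ) f x A :=
      (ContMDiff.mdifferentiableAt hf (by simp)).hasMFDerivAt
    have hA0 : A ≠ 0 := hred x hfx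
    -- At u = 0 a shear fixes `x` and adds df(velocity) to `v`. As the velocities span, df ≠ 0
    -- cannot vanish on all of them.
    obtain ⟨φ, hφ, hφA⟩ : ∃ φ ∈ 𝓕, A (flowVelocity E φ x) ≠ 0 := by
      by_contra! h
      refine hA0 (ContinuousLinearMap.ext fun ξ => ?_)
      have hle : (⊤ : Submodule ℂ E) ≤ LinearMap.ker (A : E →ₗ[ℂ] ℂ) := by
        rw [← hspan x, Submodule.span_le]
        rintro _ ⟨φ, hφ, rfl⟩
        exact h φ hφ
      exact hle (Submodule.mem_top (x := ξ))
    obtain ⟨g, hg, hgs⟩ := hshear φ hφ 1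
    have hgp : g (0, 0, x) = (0, A (flowVelocity E φ x), x) := by
      rw [hgs]
      simp only [one_mul, shear, zero_add, (h𝓕 φ hφ).zero, flowSlope_zero_eq (h𝓕 φ hφ) hA]
    refine hR.trans ⟨g, hg, hgp⟩ (hv _ _ _ ?_ hφA)
    change 0 * _ - f x = 0
    rw [hfx]
    ring
  exact hR.trans (hall p.1 p.2) (hR.symm (hall q.1 q.2))

theorem flowVelocity_eq {Θ : VField E X} {φ : ℂ → X → X} (hφ : IsHolFlow E φ)
    (hvel : ∀ x t, HasMFDerivAt 𝓘(ℂ, ℂ) 𝓘(ℂ, E) (fun s => φ s x) t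
      ((1 : ℂ →L[ℂ] ℂ).smulRight (Θ (φ t x)))) (x : X) : flowVelocity E φ x = Θ x := by
  have h1 : flowVelocity E φ x = ((1 : ℂ →L[ℂ] ℂ).smulRight (show E from Θ (φ 0 x))) 1 :=
    congrArg (fun A : ℂ →L[ℂ] E => A 1) (hvel x 0).mfderiv
  rw [h1]
  have h2 : ∀ y : X, y = x → (show E from Θ y) = (show E from Θ x) := by
    rintro y rfl
    rfl
  have h3 : ∀ v : E, ((1 : ℂ →L[ℂ] ℂ).smulRight v) 1 = v := fun v => by simp
  exact (h3 _).trans (h2 _ (hφ.zero x))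

/-- The conjugate of a flow by an automorphism. -/
theorem IsHolFlow.conj {φ : ℂ → X → X} (hφ : IsHolFlow E φ)
    (Φ : Diffeomorph 𝓘(ℂ, E) 𝓘(ℂ, E) X X ω) : IsHolFlow E fun s x => Φ (φ s (Φ.symm x)) where
  zero x := by rw [hφ.zero, Φ.apply_symm_apply]
  add s t x := by rw [Φ.symm_apply_apply, hφ.add]
  contMDiff := by
    have h1 : ContMDiff (𝓘(ℂ, ℂ).prod 𝓘(ℂ, E)) (𝓘(ℂ, ℂ).prod 𝓘(ℂ, E)) ω
        (fun p : ℂ × X => (p.1, Φ.symm p.2)) :=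
      contMDiff_fst.prodMk (Φ.symm.contMDiff.comp contMDiff_snd)
    have h2 := ContMDiff.comp (g := fun p : ℂ × X => φ p.1 p.2) hφ.contMDiff h1
    exact Φ.contMDiff.comp h2

theorem flowVelocity_conj {φ : ℂ → X → X} (hφ : IsHolFlow E φ)
    (Φ : Diffeomorph 𝓘(ℂ, E) 𝓘(ℂ, E) X X ω) (x : X) :
    flowVelocity E (fun s x => Φ (φ s (Φ.symm x))) (Φ x) =
      modelDeriv E Φ x (flowVelocity E φ x) := by
  have h0 : (fun s => Φ (φ s (Φ.symm (Φ x)))) = Φ ∘ fun s => φ s x := by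
    ext s
    rw [Φ.symm_apply_apply]
    rfl
  have h1 := mfderiv_comp (0 : ℂ) (Φ.contMDiff.mdifferentiableAt (by simp))
    ((hφ.contMDiff_time x).mdifferentiableAt (by simp))
  rw [flowVelocity, h0]
  have h2 := congrArg (fun A : ℂ →L[ℂ] E => A 1) h1
  refine h2.trans ?_
  change modelDeriv E Φ (φ 0 x) (flowVelocity E φ x) = _
  rw [hφ.zero]

theorem PreservesForm.symm {η : TopForm E X} {Φ : Diffeomorph 𝓘(ℂ, E) 𝓘(ℂ, E) X X ω}
    (h : PreservesForm E η Φ) : PreservesForm E η Φ.symm := by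
  rw [preservesForm_iff] at *
  intro x w
  have h1 := h (Φ.symm x) fun i => modelDeriv E Φ.symm x (w i)
  have h2 : (Φ ∘ Φ.symm : X → X) = id := funext Φ.apply_symm_apply
  simp only [← modelDeriv_comp Φ.contMDiff Φ.symm.contMDiff, h2, modelDeriv_id] at h1
  rw [← h1]
  exact topForm_congr η (Φ.apply_symm_apply x) w

/-- Volume flexibility at one point spreads along the orbit of the volume preserving
automorphisms. -/
theorem span_flowVelocity_of_volumeFlexibleAt [IsManifold 𝓘(ℂ, E) ω X] [FiniteDimensional ℂ E]
    [T2Space X] {η : TopForm E X} (hη : IsVolumeForm η) {x : X} (hx : IsVolumeFlexibleAt η x)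
    {Φ : Diffeomorph 𝓘(ℂ, E) 𝓘(ℂ, E) X X ω} (hΦ : Φ ∈ volumeAut η) :
    Submodule.span ℂ {ξ : E | ∃ φ ∈ {φ : ℂ → X → X | IsHolFlow E φ ∧ ∀ t, PreservesForm E η (φ t)},
      flowVelocity E φ (Φ x) = ξ} = ⊤ := by
  have : CompleteSpace E := FiniteDimensional.complete ℂ E
  have hΦ' : PreservesForm E η Φ := hΦ
  have hspan : Submodule.span ℂ {ξ : E | ∃ Θ : VField E X, IsCompleteField Θ ∧ IsDivFree η Θ ∧
      Θ x = ξ} = ⊤ := hx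
  have hsurj : Function.Surjective (modelDeriv E Φ x) := by
    intro v
    have h2 : (Φ ∘ Φ.symm : X → X) = id := funext Φ.apply_symm_apply
    have h3 := modelDeriv_comp (x := Φ x) Φ.contMDiff Φ.symm.contMDiff v
    rw [h2, modelDeriv_id, Φ.symm_apply_apply] at h3
    exact ⟨_, h3.symm⟩
  have hmap : Submodule.map (modelDeriv E Φ x : E →ₗ[ℂ] E) (Submodule.span ℂ {ξ : E |
      ∃ Θ : VField E X, IsCompleteField Θ ∧ IsDivFree η Θ ∧ Θ x = ξ}) = ⊤ := by
    rw [hspan, Submodule.map_top]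
    exact LinearMap.range_eq_top.2 hsurj
  rw [eq_top_iff, ← hmap, Submodule.map_span, Submodule.span_le]
  rintro _ ⟨_, ⟨Θ, hΘ, hdiv, rfl⟩, rfl⟩
  obtain ⟨φ, hφ, hvel⟩ := hΘ.exists_flow
  -- The flow of `Θ` conjugated by `Φ` preserves `η`, and its velocity at Φ(x) is the image of Θ(x)
  -- under dΦ. Working with flows rather than fields makes it unnecessary to compute the divergence
  -- of the transported field.
  refine Submodule.subset_span ⟨_, ⟨hφ.conj Φ, fun t => ?_⟩, ?_⟩
  · exact hΦ'.comp Φ.contMDiff ((hφ.contMDiff_space t).comp Φ.symm.contMDiff)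
      ((preservesForm_flow hη hdiv hφ hvel t).comp (hφ.contMDiff_space t) Φ.symm.contMDiff
        hΦ'.symm)
  · rw [flowVelocity_conj hφ, flowVelocity_eq hφ hvel]
    rfl

end Conclusion

end Suspension

theorem lemma3p5 {E : Type*} [NormedAddCommGroup E] [NormedSpace ℂ E]
    {X : Type*} [TopologicalSpace X] [ChartedSpace E X] [IsManifold 𝓘(ℂ, E) ω X]
    [FiniteDimensional ℂ E] [T2Space X] [SecondCountableTopology X] [ConnectedSpace X]
    (hX : Suspension.IsStein E X)
    (f : X → ℂ) (hf : Suspension.IsHolFun E f)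
    (hconst : ∃ x y : X, f x ≠ f y)
    (hred : ∀ x : X, f x = 0 → mfderiv 𝓘(ℂ, E) 𝓘(ℂ, ℂ) f x ≠ 0) :
    (Suspension.IsFlexible E X →
      ∀ p q : Suspension.Susp f, ∃ Φ ∈ Suspension.aut E f, Φ p = q) ∧
    (∀ η : Suspension.TopForm E X, Suspension.IsVolumeForm η →
      (∃ x : X, Suspension.IsVolumeFlexibleAt η x) →
      (∀ x y : X, ∃ Φ ∈ Suspension.volumeAut η, Φ x = y) →
      ∀ p q : Suspension.Susp f, ∃ Φ ∈ Suspension.suspVolumeAut f η, Φ p = q) := by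
  have : CompleteSpace E := FiniteDimensional.complete ℂ E
  open Suspension in
  constructor
  · intro hflex p q
    have hspan : ∀ x, Submodule.span ℂ {ξ : E | ∃ φ ∈ {φ : ℂ → X → X | IsHolFlow E φ},
        flowVelocity E φ x = ξ} = ⊤ := by
      intro x
      have hx : Submodule.span ℂ {ξ : E | ∃ Θ : VField E X, IsCompleteField Θ ∧ Θ x = ξ} = ⊤ :=
        hflex x
      rw [eq_top_iff, ← hx, Submodule.span_le]
      rintro _ ⟨Θ, hΘ, rfl⟩
      obtain ⟨φ, hφ, hvel⟩ := hΘ.exists_flow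
      exact Submodule.subset_span ⟨φ, hφ, flowVelocity_eq hφ hvel x⟩
    obtain ⟨g, hg, hgp⟩ := exists_mem_map_eq hf hconst hred (fun φ hφ => hφ) hspan (ambAut E f)
      (fun φ hφ t => ⟨_, shearEquiv_mem_ambAut hf (IsHolFlow.scale hφ t), fun _ => rfl⟩)
      (fun l hl => hyperbolic_mem_ambAut f hl)
      (fun g hg => mul_mem (mul_mem (exchange_mem_ambAut f) hg) (exchange_mem_ambAut f)) p q
    exact ⟨restrictSusp ⟨g, hg⟩, restrictSusp_mem_aut hf _, Subtype.ext hgp⟩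
  · rintro η hη ⟨x₀, hx₀⟩ htrans p q
    have hspan : ∀ x, Submodule.span ℂ {ξ : E | ∃ φ ∈ {φ : ℂ → X → X | IsHolFlow E φ ∧
        ∀ t, PreservesForm E η (φ t)}, flowVelocity E φ x = ξ} = ⊤ := by
      intro x
      obtain ⟨Φ, hΦ, rfl⟩ := htrans x₀ x
      exact span_flowVelocity_of_volumeFlexibleAt hη hx₀ hΦ
    obtain ⟨g, hg, hgp⟩ := exists_mem_map_eq hf hconst hred (fun φ hφ => hφ.1) hspan
      (ambVolumeAut f η)
      (fun φ hφ t => ⟨_, ⟨shearEquiv_mem_ambAut hf (IsHolFlow.scale hφ.1 t),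
        scalesForm_shear hf (IsHolFlow.scale hφ.1 t) fun s => hφ.2 (t * s)⟩, fun _ => rfl⟩)
      (fun l hl => hyperbolic_mem_ambVolumeAut f η hl)
      (fun g hg => exchange_conj_mem_ambVolumeAut hg) p q
    exact ⟨restrictSusp ⟨g, hg.1⟩, restrictSusp_mem_suspVolumeAut hf hred hg, Subtype.ext hgp⟩
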